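/- Let $D=\{x\in\mathbb R^2: |x|\le 1\}$ be the unit disk. A set $\Lambda\subseteq\mathbb R^2$ is called an orthogonal set of exponentials for $D$ if the functions $e_\lambda(x)=e^{2\pi i\langle\lambda, x\rangle}$, $\lambda\in\Lambda$, are pairwise orthogonal in $L^2(D)$, that is, $\int_D e_\lambda\overline{e_\mu}\,dx=0$ for all distinct $\lambda,\mu\in\Lambda$. There are absolute constants $C_1,C_2>0$ such that for every orthogonal set of exponentials $\Lambda\subseteq\mathbb R^2$ for $D$ the following holds. Put $$t=\inf\{|\lambda-\mu| : \lambda,\mu\in\Lambda,\ \lambda\neq\mu\}$$ (with $|\cdot|$ the Euclidean norm, and $t=+\infty$ if $\Lambda$ has at most one element). Then $t>0$ and $|\Lambda|\le C_1 t$; in particular $\Lambda$ is finite. Furthermore, $|\Lambda\cap[-R,R]^2|\le C_2R^{2/3}$ for all $R\ge 1$. -/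

import Mathlib

open MeasureTheory

/-- The exponential `x ↦ exp (2 π i ⟨l, x⟩)` on the Euclidean plane, with frequency `l`. -/
noncomputable def planeExp (l x : EuclideanSpace ℝ (Fin 2)) : ℂ :=
  Complex.exp (2 * Real.pi * Complex.I * (inner ℝ l x : ℝ))

/-- The inner product `∫_D f conj(g)` of `L²(D)`, where `D = {x : |x| ≤ 1}` is the unit disk
with Lebesgue measure. -/
noncomputable def diskInner (f g : EuclideanSpace ℝ (Fin 2) → ℂ) : ℂ :=
  ∫ x in Metric.closedBall (0 : EuclideanSpace ℝ (Fin 2)) 1, f x * (starRingEnd ℂ) (g x)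

/-- `S` is an orthogonal set of exponentials for the unit disk: the exponentials with distinct
frequencies in `S` are orthogonal in `L²(D)`. -/
def IsDiskOrthogonal (S : Set (EuclideanSpace ℝ (Fin 2))) : Prop :=
  S.Pairwise fun l m => diskInner (planeExp l) (planeExp m) = 0

/-- The closed square `[-R, R]²` in the Euclidean plane. -/
def closedSquare (R : ℝ) : Set (EuclideanSpace ℝ (Fin 2)) :=
  {x | ∀ i, x i ∈ Set.Icc (-R) R}

/-- The one-dimensional Fourier integral `∫_{-1}^1 √(1 - x²) e^{izx} dx`. -/
noncomputable def semicircleTransform (z : ℝ) : ℂ :=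
  ∫ x in (-1 : ℝ)..1, (√(1 - x ^ 2) : ℂ) * Complex.exp (z * x * Complex.I)

/-- The Laplace transform of `√y √(2 - iy)`. -/
noncomputable def edgeIntegral (z : ℝ) : ℂ :=
  ∫ y in Set.Ioi (0 : ℝ),
    ((√y * Real.exp (-(z * y)) : ℝ) : ℂ) * Complex.sqrt (2 - y * Complex.I)

theorem Complex.sqrt_sq_eq (w : ℂ) : w.sqrt ^ 2 = w :=
  Complex.cpow_ofNat_inv_pow w 2

theorem Complex.sqrt_re_nonneg (w : ℂ) : 0 ≤ w.sqrt.re := by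
  rw [Complex.sqrt, Complex.cpow_inv_two_re]
  exact Real.sqrt_nonneg _

theorem continuousAt_csqrt {w : ℂ} (hw : 0 ≤ w.re ∨ w.im ≠ 0) :
    ContinuousAt Complex.sqrt w :=
  Complex.continuousAt_cpow_const_of_re_pos hw (by norm_num)

theorem Complex.norm_sqrt (w : ℂ) : ‖w.sqrt‖ = √‖w‖ := by
  rw [eq_comm, Real.sqrt_eq_iff_mul_self_eq (norm_nonneg _) (norm_nonneg _), ← norm_mul, ← pow_two,
    Complex.sqrt_sq_eq]

theorem Complex.sqrt_real_mul_I {y : ℝ} (hy : 0 < y) :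
    Complex.sqrt (y * Complex.I) = √y * Complex.exp (Real.pi / 4 * Complex.I) := by
  rw [_root_.sqrt_eq_exp (by simp [hy.ne']), Complex.log_ofReal_mul hy Complex.I_ne_zero,
    Complex.log_I, Real.sqrt_eq_rpow, Real.rpow_def_of_pos hy, Complex.ofReal_exp, ← Complex.exp_add]
  congr 1
  push_cast
  ring

theorem Complex.sqrt_conj_of_re_pos {w : ℂ} (hw : 0 < w.re) :
    Complex.sqrt ((starRingEnd ℂ) w) = (starRingEnd ℂ) w.sqrt := by
  have harg : w.arg ≠ Real.pi := by
    intro h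
    rw [Complex.arg_eq_pi_iff] at h
    linarith [h.1]
  have h := Complex.conj_cpow w (2⁻¹ : ℂ) harg
  rw [Complex.sqrt, h, Complex.sqrt]
  congr 2
  simp [map_ofNat (starRingEnd ℂ) 2]

/-- The analytic continuation of the integrand of `semicircleTransform` to the upper half strip. -/
noncomputable def stripIntegrand (z : ℝ) (w : ℂ) : ℂ :=
  Complex.sqrt (1 - w) * Complex.sqrt (1 + w) * Complex.exp (z * w * Complex.I)

theorem stripIntegrand_ofReal (z : ℝ) {x : ℝ} (hx : x ∈ Set.Icc (-1 : ℝ) 1) :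
    stripIntegrand z x = (√(1 - x ^ 2) : ℂ) * Complex.exp (z * x * Complex.I) := by
  have h1 : (0 : ℝ) ≤ 1 - x := by linarith [hx.2]
  have h2 : (0 : ℝ) ≤ 1 + x := by linarith [hx.1]
  have e1 : Complex.sqrt (1 - x) = √(1 - x) := by
    have := Complex.sqrt_of_nonneg (a := ((1 - x : ℝ) : ℂ)) (by exact_mod_cast h1)
    simpa using this
  have e2 : Complex.sqrt (1 + x) = √(1 + x) := by
    have := Complex.sqrt_of_nonneg (a := ((1 + x : ℝ) : ℂ)) (by exact_mod_cast h2)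
    simpa using this
  rw [stripIntegrand, e1, e2, ← Complex.ofReal_mul, ← Real.sqrt_mul h1]
  congr 3
  ring

theorem two_sub_mul_I_re (y : ℝ) : (2 - y * Complex.I : ℂ).re = 2 := by simp

theorem stripIntegrand_left (z : ℝ) {y : ℝ} (hy : 0 < y) :
    stripIntegrand z ((-1 : ℝ) + y * Complex.I) =
      Complex.exp ((Real.pi / 4 - z) * Complex.I) *
        (((√y * Real.exp (-(z * y)) : ℝ) : ℂ) * Complex.sqrt (2 - y * Complex.I)) := by
  have e1 : (1 - (((-1 : ℝ) : ℂ) + y * Complex.I)) = 2 - y * Complex.I := by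
    push_cast; ring
  have e2 : (1 + (((-1 : ℝ) : ℂ) + y * Complex.I)) = y * Complex.I := by
    push_cast; ring
  have e3 : (z : ℂ) * (((-1 : ℝ) : ℂ) + y * Complex.I) * Complex.I =
      -(z * Complex.I) + ((-(z * y) : ℝ) : ℂ) := by
    push_cast
    linear_combination (z * y : ℂ) * Complex.I_sq
  rw [stripIntegrand, e1, e2, e3, Complex.sqrt_real_mul_I hy, Complex.exp_add, Complex.ofReal_mul,
    Complex.ofReal_exp,
    show ((Real.pi / 4 - z : ℂ) * Complex.I) = Real.pi / 4 * Complex.I + -(z * Complex.I) by ring,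
    Complex.exp_add]
  ring

theorem stripIntegrand_right (z y : ℝ) :
    stripIntegrand z ((1 : ℝ) + y * Complex.I) =
      (starRingEnd ℂ) (stripIntegrand z ((-1 : ℝ) + y * Complex.I)) := by
  have e1 : (1 - (((1 : ℝ) : ℂ) + y * Complex.I)) = -(y * Complex.I) := by
    push_cast; ring
  have e2 : (1 + (((1 : ℝ) : ℂ) + y * Complex.I)) = 2 + y * Complex.I := by
    push_cast; ring
  have e1' : (1 - (((-1 : ℝ) : ℂ) + y * Complex.I)) = 2 - y * Complex.I := by
    push_cast; ring
  have e2' : (1 + (((-1 : ℝ) : ℂ) + y * Complex.I)) = y * Complex.I := by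
    push_cast; ring
  have h1 : Complex.sqrt (-(y * Complex.I)) = (starRingEnd ℂ) (Complex.sqrt (y * Complex.I)) := by
    have harg : (y * Complex.I : ℂ).arg ≠ Real.pi := by
      intro h
      rw [Complex.arg_eq_pi_iff] at h
      simp at h
    have h := Complex.conj_cpow (y * Complex.I) (2⁻¹ : ℂ) harg
    rw [Complex.sqrt, Complex.sqrt]
    simpa [map_ofNat (starRingEnd ℂ) 2] using h
  have h2 : Complex.sqrt (2 + y * Complex.I) =
      (starRingEnd ℂ) (Complex.sqrt (2 - y * Complex.I)) := by
    rw [← Complex.sqrt_conj_of_re_pos (by simp)]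
    congr 1
    simp [map_ofNat (starRingEnd ℂ) 2]
  rw [stripIntegrand, stripIntegrand, e1, e2, e1', e2', h1, h2, map_mul, map_mul,
    ← Complex.exp_conj, mul_comm ((starRingEnd ℂ) (Complex.sqrt (y * Complex.I)))]
  congr 2
  simp
  ring

theorem stripIntegrand_continuousOn (z T : ℝ) (hT : 0 ≤ T) :
    ContinuousOn (stripIntegrand z) (Set.uIcc (-1 : ℝ) 1 ×ℂ Set.uIcc 0 T) := by
  intro w hw
  rw [Complex.mem_reProdIm, Set.uIcc_of_le (by norm_num), Set.uIcc_of_le hT] at hw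
  apply ContinuousAt.continuousWithinAt
  have h1 : ContinuousAt (fun w : ℂ => Complex.sqrt (1 - w)) w :=
    ContinuousAt.comp (g := Complex.sqrt) (f := fun w : ℂ => 1 - w)
      (continuousAt_csqrt (Or.inl (by simpa using hw.1.2))) (by fun_prop)
  have h2 : ContinuousAt (fun w : ℂ => Complex.sqrt (1 + w)) w :=
    ContinuousAt.comp (g := Complex.sqrt) (f := fun w : ℂ => 1 + w)
      (continuousAt_csqrt (Or.inl (by simp; linarith [hw.1.1]))) (by fun_prop)
  exact (h1.mul h2).mul (by fun_prop)

theorem stripIntegrand_differentiableOn (z T : ℝ) :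
    DifferentiableOn ℂ (stripIntegrand z)
      (Set.Ioo (min (-1 : ℝ) 1) (max (-1 : ℝ) 1) ×ℂ Set.Ioo (min 0 T) (max 0 T)) := by
  intro w hw
  rw [Complex.mem_reProdIm, min_eq_left (by norm_num), max_eq_right (by norm_num)] at hw
  apply DifferentiableAt.differentiableWithinAt
  have h1 : DifferentiableAt ℂ (fun w : ℂ => Complex.sqrt (1 - w)) w := by
    unfold Complex.sqrt
    refine DifferentiableAt.cpow_const (by fun_prop) ?_
    exact Or.inl (by simpa using hw.1.2)
  have h2 : DifferentiableAt ℂ (fun w : ℂ => Complex.sqrt (1 + w)) w := by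
    unfold Complex.sqrt
    refine DifferentiableAt.cpow_const (by fun_prop) ?_
    exact Or.inl (by simp; linarith [hw.1.1])
  exact (h1.mul h2).mul (by fun_prop)

theorem norm_stripIntegrand_top_le (z : ℝ) {x T : ℝ} (hx : x ∈ Set.Icc (-1 : ℝ) 1) (hT : 0 ≤ T) :
    ‖stripIntegrand z (x + T * Complex.I)‖ ≤ (2 + T) * Real.exp (-(z * T)) := by
  have hn : ∀ u : ℝ, |u| ≤ 2 → ∀ v : ℝ, |v| ≤ T → ‖(u + v * Complex.I : ℂ)‖ ≤ 2 + T := by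
    intro u hu v hv
    refine (norm_add_le _ _).trans ?_
    simp only [norm_mul, Complex.norm_real, Complex.norm_I, mul_one, Real.norm_eq_abs]
    linarith
  have h1 : ‖(1 - (x + T * Complex.I) : ℂ)‖ ≤ 2 + T := by
    have := hn (1 - x) (by rw [abs_le]; constructor <;> linarith [hx.1, hx.2]) (-T)
      (by rw [abs_neg, abs_of_nonneg hT])
    convert this using 2
    push_cast; ring
  have h2 : ‖(1 + (x + T * Complex.I) : ℂ)‖ ≤ 2 + T := by
    have := hn (1 + x) (by rw [abs_le]; constructor <;> linarith [hx.1, hx.2]) T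
      (by rw [abs_of_nonneg hT])
    convert this using 2
    push_cast; ring
  have h3 : ‖Complex.exp (z * (x + T * Complex.I) * Complex.I)‖ = Real.exp (-(z * T)) := by
    rw [Complex.norm_exp]
    congr 1
    simp
  rw [stripIntegrand, norm_mul, norm_mul, h3, Complex.norm_sqrt, Complex.norm_sqrt]
  gcongr
  calc √‖(1 - (x + T * Complex.I) : ℂ)‖ * √‖(1 + (x + T * Complex.I) : ℂ)‖
      ≤ √(2 + T) * √(2 + T) := by gcongr
    _ = 2 + T := Real.mul_self_sqrt (by linarith)

theorem integrableOn_edge {z : ℝ} (hz : 0 < z) :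
    IntegrableOn (fun y : ℝ => ((√y * Real.exp (-(z * y)) : ℝ) : ℂ) *
      Complex.sqrt (2 - y * Complex.I)) (Set.Ioi 0) := by
  have hcont : Continuous fun y : ℝ => Complex.sqrt (2 - y * Complex.I) := by
    rw [continuous_iff_continuousAt]
    intro y
    exact ContinuousAt.comp (g := Complex.sqrt) (f := fun y : ℝ => (2 - y * Complex.I : ℂ))
      (continuousAt_csqrt (Or.inl (by simp))) (by fun_prop)
  have h1 : IntegrableOn (fun y : ℝ => y ^ (1 / 2 : ℝ) * Real.exp (-z * y ^ (1 : ℝ)))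
    (Set.Ioi 0) := integrableOn_rpow_mul_exp_neg_mul_rpow (by norm_num) (by norm_num) hz
  have h2 : IntegrableOn (fun y : ℝ => y ^ (3 / 2 : ℝ) * Real.exp (-z * y ^ (1 : ℝ)))
    (Set.Ioi 0) := integrableOn_rpow_mul_exp_neg_mul_rpow (by norm_num) (by norm_num) hz
  refine Integrable.mono' ((h1.const_mul 2).add h2) ?_ ?_
  · exact (by fun_prop : Continuous _).aestronglyMeasurable
  · filter_upwards [ae_restrict_mem measurableSet_Ioi] with y hy
    have hy : 0 < y := hy
    have hs : ‖Complex.sqrt (2 - y * Complex.I)‖ ≤ 2 + y := by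
      rw [Complex.norm_sqrt]
      have : ‖(2 - y * Complex.I : ℂ)‖ ≤ 2 + y := by
        refine (norm_sub_le _ _).trans ?_
        simp [abs_of_pos hy]
      refine (Real.sqrt_le_sqrt this).trans ?_
      rw [Real.sqrt_le_left (by linarith)]
      nlinarith
    have e : y ^ (3 / 2 : ℝ) = y ^ (1 / 2 : ℝ) * y := by
      rw [← Real.rpow_add_one hy.ne']
      norm_num
    rw [norm_mul, Complex.norm_real, Real.norm_of_nonneg (by positivity)]
    simp only [Pi.add_apply, Real.rpow_one, e]
    rw [Real.sqrt_eq_rpow, ← neg_mul]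
    have : 0 ≤ y ^ (1 / 2 : ℝ) * Real.exp (-z * y) := by positivity
    nlinarith

theorem semicircleTransform_eq {z : ℝ} (hz : 0 < z) :
    semicircleTransform z =
      ((-2 * (Complex.exp ((Real.pi / 4 - z) * Complex.I) * edgeIntegral z).im : ℝ) : ℂ) := by
  set W : ℂ := Complex.exp ((Real.pi / 4 - z) * Complex.I) * edgeIntegral z with hW
  set F : ℝ → ℂ := fun y => Complex.exp ((Real.pi / 4 - z) * Complex.I) *
        (((√y * Real.exp (-(z * y)) : ℝ) : ℂ) * Complex.sqrt (2 - y * Complex.I)) with hF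
  have hFint : IntegrableOn F (Set.Ioi 0) := (integrableOn_edge hz).const_mul _
  have hFW : ∫ y in Set.Ioi (0 : ℝ), F y = W := by
    rw [hW, edgeIntegral, ← integral_const_mul]
  have hrect : ∀ T : ℝ, 0 ≤ T →
      semicircleTransform z = (∫ x in (-1 : ℝ)..1, stripIntegrand z (x + T * Complex.I)) -
        Complex.I * (∫ y in (0 : ℝ)..T, (starRingEnd ℂ) (F y)) +
        Complex.I * (∫ y in (0 : ℝ)..T, F y) := by
    intro T hT
    have h := Complex.integral_boundary_rect_eq_zero_of_continuousOn_of_differentiableOn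
      (stripIntegrand z) (-1) (1 + T * Complex.I)
      (by simpa using stripIntegrand_continuousOn z T hT)
      (by simpa using stripIntegrand_differentiableOn z T)
    have hre : (1 + T * Complex.I : ℂ).re = 1 := by simp
    have him : (1 + T * Complex.I : ℂ).im = T := by simp
    have hre' : (-1 : ℂ).re = -1 := by simp
    have him' : (-1 : ℂ).im = 0 := by simp
    rw [hre, him, hre', him'] at h
    have e1 : ∫ x in (-1 : ℝ)..1, stripIntegrand z (x + (0 : ℝ) * Complex.I) =
        semicircleTransform z := by
      refine intervalIntegral.integral_congr fun x hx => ?_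
      rw [Set.uIcc_of_le (by norm_num)] at hx
      simp only [Complex.ofReal_zero, zero_mul, add_zero]
      exact stripIntegrand_ofReal z hx
    have e2 : ∫ y in (0 : ℝ)..T, stripIntegrand z ((1 : ℝ) + y * Complex.I) =
        ∫ y in (0 : ℝ)..T, (starRingEnd ℂ) (F y) := by
      refine intervalIntegral.integral_congr_ae (Filter.Eventually.of_forall fun y hy => ?_)
      rw [Set.uIoc_of_le hT] at hy
      rw [stripIntegrand_right z y, stripIntegrand_left z hy.1]
    have e3 : ∫ y in (0 : ℝ)..T, stripIntegrand z ((-1 : ℝ) + y * Complex.I) =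
        ∫ y in (0 : ℝ)..T, F y := by
      refine intervalIntegral.integral_congr_ae (Filter.Eventually.of_forall fun y hy => ?_)
      rw [Set.uIoc_of_le hT] at hy
      rw [stripIntegrand_left z hy.1]
    rw [e1, e2, e3, smul_eq_mul, smul_eq_mul] at h
    linear_combination h
  have htop : Filter.Tendsto (fun T : ℝ => ∫ x in (-1 : ℝ)..1, stripIntegrand z (x + T * Complex.I))
      Filter.atTop (nhds 0) := by
    have hb : Filter.Tendsto (fun T : ℝ => (2 + T) * Real.exp (-(z * T)) * 2)
        Filter.atTop (nhds 0) := by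
      have h0 : Filter.Tendsto (fun T : ℝ => Real.exp (-z * T)) Filter.atTop (nhds 0) := by
        simpa using tendsto_rpow_mul_exp_neg_mul_atTop_nhds_zero 0 z hz
      have h1 : Filter.Tendsto (fun T : ℝ => T * Real.exp (-z * T)) Filter.atTop (nhds 0) := by
        simpa using tendsto_rpow_mul_exp_neg_mul_atTop_nhds_zero 1 z hz
      have := (h0.const_mul 4).add (h1.const_mul 2)
      simp only [mul_zero, add_zero] at this
      refine this.congr fun T => ?_
      rw [← neg_mul]
      ring
    refine squeeze_zero_norm' ?_ hb
    filter_upwards [Filter.eventually_ge_atTop 0] with T hT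
    have := intervalIntegral.norm_integral_le_of_norm_le_const (a := -1) (b := 1)
      (f := fun x : ℝ => stripIntegrand z (x + T * Complex.I))
      (C := (2 + T) * Real.exp (-(z * T))) (fun x hx => by
        rw [Set.uIoc_of_le (by norm_num)] at hx
        exact norm_stripIntegrand_top_le z ⟨hx.1.le, hx.2⟩ hT)
    refine this.trans (le_of_eq ?_)
    norm_num
  have hl := intervalIntegral_tendsto_integral_Ioi 0 hFint Filter.tendsto_id
  have hr := intervalIntegral_tendsto_integral_Ioi 0
    (f := fun y => (starRingEnd ℂ) (F y))
    ((Complex.conjLIE.toContinuousLinearEquiv.toContinuousLinearMap.integrable_comp hFint))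
    Filter.tendsto_id
  rw [integral_conj] at hr
  have hlim := (htop.sub (hr.const_mul Complex.I)).add (hl.const_mul Complex.I)
  have hconst : Filter.Tendsto (fun _ : ℝ => semicircleTransform z) Filter.atTop
      (nhds (semicircleTransform z)) := tendsto_const_nhds
  have heq := tendsto_nhds_unique (hconst.congr' (by
    filter_upwards [Filter.eventually_ge_atTop 0] with T hT
    exact hrect T hT)) hlim
  rw [heq, hFW]
  apply Complex.ext <;> simp; ring

theorem two_le_sqrt_re_sq (y : ℝ) : 2 ≤ (Complex.sqrt (2 - y * Complex.I)).re ^ 2 ∧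
    (Complex.sqrt (2 - y * Complex.I)).re ^ 2 - (Complex.sqrt (2 - y * Complex.I)).im ^ 2 = 2 := by
  have h := congrArg Complex.re (Complex.sqrt_sq_eq (2 - y * Complex.I))
  rw [two_sub_mul_I_re, pow_two, Complex.mul_re] at h
  constructor <;> nlinarith [sq_nonneg (Complex.sqrt (2 - y * Complex.I)).im]

theorem one_le_sqrt_re (y : ℝ) : 1 ≤ (Complex.sqrt (2 - y * Complex.I)).re := by
  nlinarith [(two_le_sqrt_re_sq y).1, Complex.sqrt_re_nonneg (2 - y * Complex.I)]

theorem sqrt_re_add_im_pos (y : ℝ) :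
    0 < (Complex.sqrt (2 - y * Complex.I)).re + (Complex.sqrt (2 - y * Complex.I)).im := by
  have h := two_le_sqrt_re_sq y
  have h1 := one_le_sqrt_re y
  by_contra hneg
  push Not at hneg
  nlinarith [h.2]

theorem norm_sqrt_sub_le {y : ℝ} (hy : 0 ≤ y) :
    ‖Complex.sqrt (2 - y * Complex.I) - (√2 : ℝ)‖ ≤ y := by
  set s := Complex.sqrt (2 - y * Complex.I) with hs
  have hmul : (s - (√2 : ℝ)) * (s + (√2 : ℝ)) = -(y * Complex.I) := by
    have h2 : ((√2 : ℝ) : ℂ) ^ 2 = 2 := by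
      rw [← Complex.ofReal_pow, Real.sq_sqrt (by norm_num)]; norm_num
    have := Complex.sqrt_sq_eq (2 - y * Complex.I)
    rw [← hs] at this
    linear_combination this - h2
  have hge : 1 ≤ ‖s + (√2 : ℝ)‖ := by
    refine le_trans ?_ (Complex.re_le_norm _)
    rw [Complex.add_re, Complex.ofReal_re]
    linarith [one_le_sqrt_re y, Real.sqrt_nonneg 2]
  have hn := congrArg norm hmul
  rw [norm_mul, norm_neg, norm_mul, Complex.norm_I, mul_one, Complex.norm_real,
    Real.norm_of_nonneg hy] at hn
  nlinarith [norm_nonneg (s - (√2 : ℝ))]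

/-- The Laplace transform of `√y`, which is the main term of `edgeIntegral`. -/
noncomputable def edgeMain (z : ℝ) : ℝ := ∫ y in Set.Ioi (0 : ℝ), √y * Real.exp (-(z * y))

theorem edgeMain_eq {z : ℝ} (hz : 0 < z) :
    edgeMain z = (1 / z) ^ (3 / 2 : ℝ) * Real.Gamma (3 / 2) := by
  rw [← Real.integral_rpow_mul_exp_neg_mul_Ioi (by norm_num) hz, edgeMain]
  refine setIntegral_congr_fun measurableSet_Ioi fun y _ => ?_
  norm_num [Real.sqrt_eq_rpow]

theorem edgeMain_pos {z : ℝ} (hz : 0 < z) : 0 < edgeMain z := by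
  rw [edgeMain_eq hz]
  have := Real.Gamma_pos_of_pos (show (0 : ℝ) < 3 / 2 by norm_num)
  positivity

theorem integral_edge_error {z : ℝ} (hz : 0 < z) :
    ∫ y in Set.Ioi (0 : ℝ), √y * Real.exp (-(z * y)) * y = 3 / 2 / z * edgeMain z := by
  have h := Real.integral_rpow_mul_exp_neg_mul_Ioi (a := 5 / 2) (by norm_num) hz
  have h1 : ∫ y in Set.Ioi (0 : ℝ), √y * Real.exp (-(z * y)) * y =
      ∫ y in Set.Ioi (0 : ℝ), y ^ (5 / 2 - 1 : ℝ) * Real.exp (-(z * y)) := by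
    refine setIntegral_congr_fun measurableSet_Ioi fun y hy => ?_
    have hy : 0 < y := hy
    have e : y ^ (5 / 2 - 1 : ℝ) = √y * y := by
      rw [Real.sqrt_eq_rpow, ← Real.rpow_add_one hy.ne']
      norm_num
    simp only [e]
    ring
  have h2 : Real.Gamma (5 / 2) = 3 / 2 * Real.Gamma (3 / 2) := by
    rw [← Real.Gamma_add_one (by norm_num)]
    norm_num
  rw [h1, h, edgeMain_eq hz, h2, show (5 / 2 : ℝ) = 3 / 2 + 1 by norm_num,
    Real.rpow_add_one (by positivity)]
  field_simp

theorem integrableOn_sqrt_mul_exp {z : ℝ} (hz : 0 < z) :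
    IntegrableOn (fun y : ℝ => √y * Real.exp (-(z * y))) (Set.Ioi 0) := by
  have h1 : IntegrableOn (fun y : ℝ => y ^ (1 / 2 : ℝ) * Real.exp (-z * y ^ (1 : ℝ)))
    (Set.Ioi 0) := integrableOn_rpow_mul_exp_neg_mul_rpow (by norm_num) (by norm_num) hz
  refine h1.congr_fun (fun y _ => ?_) measurableSet_Ioi
  simp only [Real.rpow_one, Real.sqrt_eq_rpow, neg_mul]

theorem integrableOn_sqrt_mul_exp_mul {z : ℝ} (hz : 0 < z) :
    IntegrableOn (fun y : ℝ => √y * Real.exp (-(z * y)) * y) (Set.Ioi 0) := by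
  have h1 : IntegrableOn (fun y : ℝ => y ^ (3 / 2 : ℝ) * Real.exp (-z * y ^ (1 : ℝ)))
    (Set.Ioi 0) := integrableOn_rpow_mul_exp_neg_mul_rpow (by norm_num) (by norm_num) hz
  refine h1.congr_fun (fun y hy => ?_) measurableSet_Ioi
  have hy : 0 < y := hy
  have e : y ^ (3 / 2 : ℝ) = √y * y := by
    rw [Real.sqrt_eq_rpow, ← Real.rpow_add_one hy.ne']
    norm_num
  simp only [Real.rpow_one, e, neg_mul]
  ring

theorem norm_edgeIntegral_sub_le {z : ℝ} (hz : 0 < z) :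
    ‖edgeIntegral z - ((√2 * edgeMain z : ℝ) : ℂ)‖ ≤ 3 / 2 / z * edgeMain z := by
  have h1 : ((√2 * edgeMain z : ℝ) : ℂ) = ∫ y in Set.Ioi (0 : ℝ),
      ((√y * Real.exp (-(z * y)) : ℝ) : ℂ) * ((√2 : ℝ) : ℂ) := by
    rw [integral_mul_const, integral_complex_ofReal, edgeMain, mul_comm, Complex.ofReal_mul]
  have hint : IntegrableOn (fun y : ℝ => ((√y * Real.exp (-(z * y)) : ℝ) : ℂ) * ((√2 : ℝ) : ℂ))
    (Set.Ioi 0) := (integrableOn_sqrt_mul_exp hz).ofReal.mul_const _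
  rw [h1, edgeIntegral, ← integral_sub (integrableOn_edge hz) hint, ← integral_edge_error hz]
  refine norm_integral_le_of_norm_le (integrableOn_sqrt_mul_exp_mul hz) ?_
  filter_upwards [ae_restrict_mem measurableSet_Ioi] with y hy
  have hy : 0 < y := hy
  rw [← mul_sub, norm_mul, Complex.norm_real, Real.norm_of_nonneg (by positivity)]
  gcongr
  exact norm_sqrt_sub_le hy.le

theorem edgeIntegral_re_add_im_pos {z : ℝ} (hz : 0 < z) :
    0 < (edgeIntegral z).re + (edgeIntegral z).im := by
  have hint := integrableOn_edge hz
  have e1 : (edgeIntegral z).re = ∫ y in Set.Ioi (0 : ℝ),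
      (((√y * Real.exp (-(z * y)) : ℝ) : ℂ) * Complex.sqrt (2 - y * Complex.I)).re :=
    (integral_re hint).symm
  have e2 : (edgeIntegral z).im = ∫ y in Set.Ioi (0 : ℝ),
      (((√y * Real.exp (-(z * y)) : ℝ) : ℂ) * Complex.sqrt (2 - y * Complex.I)).im :=
    (integral_im hint).symm
  have hre : IntegrableOn (fun y : ℝ =>
      (((√y * Real.exp (-(z * y)) : ℝ) : ℂ) * Complex.sqrt (2 - y * Complex.I)).re)
      (Set.Ioi 0) := hint.re
  have him : IntegrableOn (fun y : ℝ =>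
      (((√y * Real.exp (-(z * y)) : ℝ) : ℂ) * Complex.sqrt (2 - y * Complex.I)).im)
      (Set.Ioi 0) := hint.im
  rw [e1, e2, ← integral_add hre him]
  have hpos : ∀ y ∈ Set.Ioi (0 : ℝ), 0 <
      (((√y * Real.exp (-(z * y)) : ℝ) : ℂ) * Complex.sqrt (2 - y * Complex.I)).re +
      (((√y * Real.exp (-(z * y)) : ℝ) : ℂ) * Complex.sqrt (2 - y * Complex.I)).im := by
    intro y hy
    have hy : 0 < y := hy
    rw [Complex.re_ofReal_mul, Complex.im_ofReal_mul, ← mul_add]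
    exact mul_pos (by positivity) (sqrt_re_add_im_pos y)
  rw [setIntegral_pos_iff_support_of_nonneg_ae]
  · have : Set.Ioi (0 : ℝ) ⊆ Function.support (fun y : ℝ =>
      (((√y * Real.exp (-(z * y)) : ℝ) : ℂ) * Complex.sqrt (2 - y * Complex.I)).re +
      (((√y * Real.exp (-(z * y)) : ℝ) : ℂ) * Complex.sqrt (2 - y * Complex.I)).im) :=
      fun y hy => (hpos y hy).ne'
    calc (0 : ENNReal) < volume (Set.Ioi (0 : ℝ)) := by simp
      _ ≤ _ := measure_mono (Set.subset_inter this subset_rfl)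
  · filter_upwards [ae_restrict_mem measurableSet_Ioi] with y hy
    exact (hpos y hy).le
  · exact hre.add him

theorem semicircleTransform_ne_zero_of_le_one {z : ℝ} (hz : 0 ≤ z) (hz1 : z ≤ 1) :
    semicircleTransform z ≠ 0 := by
  intro h
  have hcont : Continuous fun x : ℝ => (√(1 - x ^ 2) : ℂ) * Complex.exp (z * x * Complex.I) := by
    fun_prop
  have hre : (semicircleTransform z).re = ∫ x in (-1 : ℝ)..1, √(1 - x ^ 2) * Real.cos (z * x) := by
    have := Complex.reCLM.intervalIntegral_comp_comm (hcont.intervalIntegrable (μ := volume) (-1) 1)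
    rw [semicircleTransform, ← Complex.reCLM_apply, ← this]
    refine intervalIntegral.integral_congr fun x _ => ?_
    simp only [Complex.reCLM_apply]
    rw [Complex.re_ofReal_mul, ← Complex.ofReal_mul, Complex.exp_ofReal_mul_I_re]
  have hpos : 0 < ∫ x in (-1 : ℝ)..1, √(1 - x ^ 2) * Real.cos (z * x) := by
    refine intervalIntegral.intervalIntegral_pos_of_pos_on
      (Continuous.intervalIntegrable (by fun_prop) _ _) (fun x hx => ?_) (by norm_num)
    have h1 : 0 < 1 - x ^ 2 := by nlinarith [hx.1, hx.2]
    refine mul_pos (Real.sqrt_pos.2 h1) (Real.cos_pos_of_mem_Ioo ?_)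
    have : |z * x| ≤ 1 := by
      rw [abs_mul, abs_of_nonneg hz]
      have : |x| ≤ 1 := abs_le.2 ⟨hx.1.le, hx.2.le⟩
      nlinarith [abs_nonneg x]
    have h3 := Real.pi_gt_three
    rw [abs_le] at this
    constructor <;> linarith
  rw [← hre, h] at hpos
  simp at hpos

theorem sin_ne_zero_of_semicircleTransform_eq_zero {z : ℝ} (hz : 0 < z)
    (h : semicircleTransform z = 0) : Real.sin z ≠ 0 := by
  intro hs
  rw [semicircleTransform_eq hz, Complex.ofReal_eq_zero] at h
  have e : Complex.exp ((Real.pi / 4 - z) * Complex.I) =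
      ((√2 / 2 * Real.cos z : ℝ) : ℂ) * (1 + Complex.I) := by
    have e1 : ((Real.pi / 4 - z : ℂ) * Complex.I) = ((Real.pi / 4 - z : ℝ) : ℂ) * Complex.I := by
      push_cast; ring
    rw [e1]
    apply Complex.ext
    · rw [Complex.exp_ofReal_mul_I_re, Complex.re_ofReal_mul, Real.cos_sub, hs]
      simp
    · rw [Complex.exp_ofReal_mul_I_im, Complex.im_ofReal_mul, Real.sin_sub, hs]
      simp
  have hc : Real.cos z ≠ 0 := by
    intro hc
    have := Real.sin_sq_add_cos_sq z
    rw [hs, hc] at this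
    norm_num at this
  rw [e, mul_assoc, Complex.im_ofReal_mul] at h
  have e2 : ((1 + Complex.I) * edgeIntegral z).im = (edgeIntegral z).re + (edgeIntegral z).im := by
    simp [Complex.mul_im]; ring
  rw [e2] at h
  have := (edgeIntegral_re_add_im_pos hz).ne'
  have h2 : √2 ≠ 0 := by positivity
  simp_all

theorem abs_sin_sub_le_of_semicircleTransform_eq_zero {z : ℝ} (hz : 0 < z)
    (h : semicircleTransform z = 0) : |Real.sin (z - Real.pi / 4)| ≤ 3 / 2 / z := by
  rw [semicircleTransform_eq hz, Complex.ofReal_eq_zero] at h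
  set u : ℂ := Complex.exp ((Real.pi / 4 - z) * Complex.I) with hu
  have hu1 : ((Real.pi / 4 - z : ℂ) * Complex.I) = ((Real.pi / 4 - z : ℝ) : ℂ) * Complex.I := by
    push_cast; ring
  have hun : ‖u‖ = 1 := by rw [hu, hu1, Complex.norm_exp_ofReal_mul_I]
  have huim : u.im = -Real.sin (z - Real.pi / 4) := by
    rw [hu, hu1, Complex.exp_ofReal_mul_I_im, ← Real.sin_neg]
    congr 1; ring
  have hE := norm_edgeIntegral_sub_le hz
  set E := edgeIntegral z - ((√2 * edgeMain z : ℝ) : ℂ) with hEdef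
  have hL : edgeIntegral z = ((√2 * edgeMain z : ℝ) : ℂ) + E := by rw [hEdef]; ring
  have h0 : (u * edgeIntegral z).im = 0 := by linarith
  rw [hL, mul_add, Complex.add_im, mul_comm u, Complex.im_ofReal_mul, huim] at h0
  have h1 : |(u * E).im| ≤ 3 / 2 / z * edgeMain z := by
    refine (Complex.abs_im_le_norm _).trans ?_
    rwa [norm_mul, hun, one_mul]
  have h2 : (u * E).im = √2 * edgeMain z * Real.sin (z - Real.pi / 4) := by linarith
  have hG := edgeMain_pos hz
  rw [h2, abs_mul, abs_of_pos (by positivity)] at h1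
  have hs2 : 1 ≤ √2 := Real.one_le_sqrt.2 (by norm_num)
  have h3 : edgeMain z * |Real.sin (z - Real.pi / 4)| ≤ edgeMain z * (3 / 2 / z) := by
    nlinarith [mul_nonneg hG.le (abs_nonneg (Real.sin (z - Real.pi / 4)))]
  exact le_of_mul_le_mul_left h3 hG

theorem abs_sin_sub_int_mul_pi (x : ℝ) (n : ℤ) : |Real.sin (x - n * Real.pi)| = |Real.sin x| := by
  rw [Real.sin_sub_int_mul_pi, abs_mul, abs_zpow]
  simp

theorem exists_int_abs_sub_le_of_semicircleTransform_eq_zero {z : ℝ} (hz : 0 < z)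
    (h : semicircleTransform z = 0) : ∃ n : ℤ, |z - Real.pi / 4 - n * Real.pi| ≤ 3 / z := by
  have hs := abs_sin_sub_le_of_semicircleTransform_eq_zero hz h
  set n : ℤ := round ((z - Real.pi / 4) / Real.pi)
  refine ⟨n, ?_⟩
  have hpi := Real.pi_pos
  have hr : |(z - Real.pi / 4) / Real.pi - n| ≤ 1 / 2 := abs_sub_round _
  have hx : |z - Real.pi / 4 - n * Real.pi| ≤ Real.pi / 2 := by
    have e : z - Real.pi / 4 - n * Real.pi = ((z - Real.pi / 4) / Real.pi - n) * Real.pi := by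
      field_simp
    rw [e, abs_mul, abs_of_pos hpi]
    nlinarith
  have h1 := Real.mul_abs_le_abs_sin hx
  rw [abs_sin_sub_int_mul_pi] at h1
  have h2 : 2 / Real.pi * |z - Real.pi / 4 - n * Real.pi| ≤ 3 / 2 / z := h1.trans hs
  have h4 : 1 / 2 ≤ 2 / Real.pi := by
    rw [div_le_div_iff₀ (by norm_num) hpi]; linarith [Real.pi_le_four]
  have h5 := mul_le_mul_of_nonneg_right h4 (abs_nonneg (z - Real.pi / 4 - n * Real.pi))
  have h6 : 3 / z = 2 * (3 / 2 / z) := by ring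
  linarith

theorem continuous_semicircleTransform : Continuous semicircleTransform := by
  unfold semicircleTransform
  exact intervalIntegral.continuous_parametric_intervalIntegral_of_continuous' (by fun_prop) _ _

theorem exists_le_abs_sin_of_semicircleTransform_eq_zero :
    ∃ δ : ℝ, 0 < δ ∧ ∀ z : ℝ, 0 < z → semicircleTransform z = 0 → δ ≤ |Real.sin z| := by
  have hK : IsCompact (Set.Icc (1 : ℝ) 12 ∩ semicircleTransform ⁻¹' {0}) :=
    isCompact_Icc.inter_right (isClosed_singleton.preimage continuous_semicircleTransform)
  obtain ⟨δ, hδ, hKδ⟩ : ∃ δ : ℝ, 0 < δ ∧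
      ∀ z ∈ Set.Icc (1 : ℝ) 12 ∩ semicircleTransform ⁻¹' {0}, δ ≤ |Real.sin z| := by
    rcases (Set.Icc (1 : ℝ) 12 ∩ semicircleTransform ⁻¹' {0}).eq_empty_or_nonempty with he | hne
    · exact ⟨1, one_pos, by simp [he]⟩
    · obtain ⟨w, hw, hmin⟩ := hK.exists_isMinOn hne
        (f := fun z => |Real.sin z|) (by fun_prop)
      exact ⟨|Real.sin w|, abs_pos.2 (sin_ne_zero_of_semicircleTransform_eq_zero
        (by linarith [hw.1.1]) hw.2), fun z hz => hmin hz⟩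
  refine ⟨min δ (1 / 4), by positivity, fun z hz h => ?_⟩
  have h1 : 1 < z := by
    by_contra h1
    exact semicircleTransform_ne_zero_of_le_one hz.le (not_lt.1 h1) h
  rcases le_or_gt z 12 with h12 | h12
  · exact (min_le_left _ _).trans (hKδ z ⟨⟨h1.le, h12⟩, h⟩)
  · refine (min_le_right _ _).trans ?_
    obtain ⟨n, hn⟩ := exists_int_abs_sub_le_of_semicircleTransform_eq_zero hz h
    have hn' : |z - Real.pi / 4 - n * Real.pi| ≤ 1 / 4 := by
      refine hn.trans ?_
      rw [div_le_div_iff₀ hz (by norm_num)]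
      linarith
    rw [← abs_sin_sub_int_mul_pi z n]
    rw [abs_le] at hn'
    have hp3 := Real.pi_gt_three
    have hp4 := Real.pi_le_four
    have hpos : 1 / 2 ≤ z - n * Real.pi := by linarith
    have h2 := Real.mul_le_sin (x := z - n * Real.pi) (by linarith) (by linarith)
    have h4 : 1 / 2 ≤ 2 / Real.pi := by
      rw [div_le_div_iff₀ (by norm_num) (by linarith)]; linarith
    refine le_trans ?_ (le_abs_self _)
    nlinarith

/-- The zeros of the Fourier transform of the disk, as functions of the radius: they are bounded
below, asymptotic to `1/8 + ℤ/2`, and uniformly bounded away from `ℤ/2`. -/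
theorem exists_zero_constants : ∃ t₀ C δ : ℝ, 0 < t₀ ∧ 0 < C ∧ 0 < δ ∧
    ∀ r : ℝ, 0 < r → semicircleTransform (2 * Real.pi * r) = 0 →
      t₀ ≤ r ∧ (∃ n : ℤ, |r - 1 / 8 - n / 2| ≤ C / r) ∧ ∀ n : ℤ, δ ≤ |r - n / 2| := by
  obtain ⟨δ, hδ, hsin⟩ := exists_le_abs_sin_of_semicircleTransform_eq_zero
  have hpi := Real.pi_pos
  have hp3 := Real.pi_gt_three
  refine ⟨1 / (2 * Real.pi), 1, δ / (2 * Real.pi), by positivity, one_pos, by positivity,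
    fun r hr h => ?_⟩
  have hz : 0 < 2 * Real.pi * r := by positivity
  refine ⟨?_, ?_, fun n => ?_⟩
  · by_contra hlt
    rw [not_le, lt_div_iff₀ (by positivity)] at hlt
    exact semicircleTransform_ne_zero_of_le_one hz.le (by linarith) h
  · obtain ⟨n, hn⟩ := exists_int_abs_sub_le_of_semicircleTransform_eq_zero hz h
    refine ⟨n, ?_⟩
    have e : 2 * Real.pi * r - Real.pi / 4 - n * Real.pi = 2 * Real.pi * (r - 1 / 8 - n / 2) := by
      ring
    rw [e, abs_mul, abs_of_pos (by positivity), le_div_iff₀ hz] at hn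
    rw [le_div_iff₀ hr]
    nlinarith [mul_nonneg (abs_nonneg (r - 1 / 8 - n / 2)) hr.le, mul_nonneg (mul_nonneg
      (abs_nonneg (r - 1 / 8 - n / 2)) hr.le) (by nlinarith : (0 : ℝ) ≤ Real.pi * Real.pi - 9)]
  · rw [div_le_iff₀ (by positivity)]
    calc δ ≤ |Real.sin (2 * Real.pi * r - n * Real.pi)| := by
          rw [abs_sin_sub_int_mul_pi]; exact hsin _ hz h
      _ ≤ |2 * Real.pi * r - n * Real.pi| := Real.abs_sin_le_abs
      _ = |r - n / 2| * (2 * Real.pi) := by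
          rw [← abs_of_pos (show 0 < 2 * Real.pi by positivity), ← abs_mul,
            abs_of_pos (show 0 < 2 * Real.pi by positivity)]
          congr 1; ring

theorem setIntegral_disk_fst {F : ℝ → ℂ} (hF : Continuous F) :
    ∫ p in {p : ℝ × ℝ | p.1 ^ 2 + p.2 ^ 2 ≤ 1}, F p.1 =
      2 * ∫ x in (-1 : ℝ)..1, (√(1 - x ^ 2) : ℂ) * F x := by
  set D : Set (ℝ × ℝ) := {p : ℝ × ℝ | p.1 ^ 2 + p.2 ^ 2 ≤ 1} with hD
  have hclosed : IsClosed D := isClosed_le (by fun_prop) (by fun_prop)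
  have hcomp : IsCompact D := by
    refine (isCompact_Icc (a := ((-1 : ℝ), (-1 : ℝ))) (b := ((1 : ℝ), (1 : ℝ)))).of_isClosed_subset
      hclosed fun p hp => ?_
    have hp : p.1 ^ 2 + p.2 ^ 2 ≤ 1 := hp
    have h1 : |p.1| ≤ 1 := abs_le_one_iff_mul_self_le_one.2 (by nlinarith [sq_nonneg p.2])
    have h2 : |p.2| ≤ 1 := abs_le_one_iff_mul_self_le_one.2 (by nlinarith [sq_nonneg p.1])
    exact ⟨⟨(abs_le.1 h1).1, (abs_le.1 h2).1⟩, ⟨(abs_le.1 h1).2, (abs_le.1 h2).2⟩⟩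
  have hint : IntegrableOn (fun p : ℝ × ℝ => F p.1) D :=
    (hF.comp continuous_fst).continuousOn.integrableOn_compact hcomp
  rw [← integral_indicator hclosed.measurableSet, Measure.volume_eq_prod,
    integral_prod _ (by
      rw [← Measure.volume_eq_prod]; exact (integrable_indicator_iff hclosed.measurableSet).2 hint)]
  have hslice : ∀ x : ℝ, ∫ y, D.indicator (fun p : ℝ × ℝ => F p.1) (x, y) =
      2 * ((√(1 - x ^ 2) : ℂ) * F x) := by
    intro x
    rcases le_or_gt (x ^ 2) 1 with hx | hx
    · have hx' : 0 ≤ 1 - x ^ 2 := by linarith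
      have e : (fun y => D.indicator (fun p : ℝ × ℝ => F p.1) (x, y)) =
          (Set.Icc (-√(1 - x ^ 2)) (√(1 - x ^ 2))).indicator fun _ => F x := by
        ext y
        have : (x, y) ∈ D ↔ y ∈ Set.Icc (-√(1 - x ^ 2)) (√(1 - x ^ 2)) := by
          rw [Set.mem_Icc, ← Real.sq_le hx', hD, Set.mem_ofPred_eq]
          constructor <;> intro h <;> linarith
        by_cases hy : (x, y) ∈ D
        · rw [Set.indicator_of_mem hy, Set.indicator_of_mem (this.1 hy)]
        · rw [Set.indicator_of_notMem hy, Set.indicator_of_notMem (fun h => hy (this.2 h))]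
      rw [e, integral_indicator measurableSet_Icc, setIntegral_const]
      have hv : volume.real (Set.Icc (-√(1 - x ^ 2)) (√(1 - x ^ 2))) = 2 * √(1 - x ^ 2) := by
        rw [Real.volume_real_Icc_of_le (by linarith [Real.sqrt_nonneg (1 - x ^ 2)])]
        ring
      rw [hv, Complex.real_smul]
      push_cast
      ring
    · have e : (fun y => D.indicator (fun p : ℝ × ℝ => F p.1) (x, y)) = fun _ => 0 := by
        ext y
        refine Set.indicator_of_notMem (fun h => ?_) _
        have h : x ^ 2 + y ^ 2 ≤ 1 := h
        nlinarith [sq_nonneg y]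
      rw [e, Real.sqrt_eq_zero'.2 (by linarith)]
      simp
  simp_rw [hslice]
  rw [integral_const_mul]
  congr 1
  rw [intervalIntegral.integral_eq_integral_of_support_subset]
  intro x hx
  rw [Function.mem_support] at hx
  have h : 0 < 1 - x ^ 2 := by
    by_contra hneg
    exact hx (by rw [Real.sqrt_eq_zero'.2 (not_lt.1 hneg)]; simp)
  constructor <;> nlinarith

theorem setIntegral_complex_disk_re {F : ℝ → ℂ} (hF : Continuous F) :
    ∫ w in Metric.closedBall (0 : ℂ) 1, F w.re =
      2 * ∫ x in (-1 : ℝ)..1, (√(1 - x ^ 2) : ℂ) * F x := by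
  rw [← setIntegral_disk_fst hF]
  have h := Complex.volume_preserving_equiv_real_prod.setIntegral_preimage_emb
    Complex.measurableEquivRealProd.measurableEmbedding (fun p : ℝ × ℝ => F p.1)
    {p : ℝ × ℝ | p.1 ^ 2 + p.2 ^ 2 ≤ 1}
  rw [← h]
  congr 2
  ext w
  rw [mem_closedBall_zero_iff, Set.mem_preimage, Set.mem_ofPred_eq,
    Complex.measurableEquivRealProd_apply, ← sq_le_one_iff₀ (norm_nonneg w), Complex.sq_norm,
    Complex.normSq_apply, pow_two, pow_two]

theorem exists_isometry_complex (v : EuclideanSpace ℝ (Fin 2)) :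
    ∃ ψ : ℂ ≃ₗᵢ[ℝ] EuclideanSpace ℝ (Fin 2), ψ (‖v‖ : ℂ) = v := by
  set φ := Complex.orthonormalBasisOneI.repr with hφ
  set w : ℂ := φ.symm v with hw
  have hn : ‖w‖ = ‖v‖ := φ.symm.norm_map v
  refine ⟨(rotation (Circle.exp w.arg)).trans φ, ?_⟩
  rw [LinearIsometryEquiv.trans_apply, rotation_apply, Circle.coe_exp, ← hn, mul_comm,
    Complex.norm_mul_exp_arg_mul_I, hw, LinearIsometryEquiv.apply_symm_apply]

theorem diskInner_planeExp (l m : EuclideanSpace ℝ (Fin 2)) :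
    diskInner (planeExp l) (planeExp m) = 2 * semicircleTransform (2 * Real.pi * ‖l - m‖) := by
  obtain ⟨ψ, hψ⟩ := exists_isometry_complex (l - m)
  have e1 : ∀ x, planeExp l x * (starRingEnd ℂ) (planeExp m x) =
      Complex.exp (2 * Real.pi * Complex.I * (inner ℝ (l - m) x : ℝ)) := by
    intro x
    rw [planeExp, planeExp, ← Complex.exp_conj, ← Complex.exp_add, inner_sub_left]
    congr 1
    simp [map_ofNat (starRingEnd ℂ) 2]
    ring
  have e2 : ∀ w : ℂ, inner ℝ (l - m) (ψ w) = ‖l - m‖ * w.re := by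
    intro w
    conv_lhs => rw [← hψ]
    rw [LinearIsometryEquiv.inner_map_map, Complex.inner]
    simp [mul_comm]
  have h := ψ.measurePreserving.setIntegral_preimage_emb
    ψ.toHomeomorph.measurableEmbedding
    (fun x => Complex.exp (2 * Real.pi * Complex.I * (inner ℝ (l - m) x : ℝ)))
    (Metric.closedBall 0 1)
  rw [diskInner]
  simp_rw [e1]
  rw [← h, LinearIsometryEquiv.preimage_closedBall, map_zero]
  simp_rw [e2]
  rw [setIntegral_complex_disk_re (F := fun x => Complex.exp (2 * Real.pi * Complex.I *
    ((‖l - m‖ * x : ℝ) : ℂ))) (by fun_prop), semicircleTransform]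
  congr 2
  ext x
  congr 2
  push_cast
  ring

theorem card_le_of_separated {E : Type*} [NormedAddCommGroup E] [NormedSpace ℝ E]
    [FiniteDimensional ℝ E] [Nontrivial E] (F : Finset E) (c : E) {R s : ℝ} (hR : 0 ≤ R) (hs : 0 < s)
    (hball : ∀ z ∈ F, dist z c ≤ R) (hsep : ∀ z ∈ F, ∀ w ∈ F, z ≠ w → s ≤ dist z w) :
    (F.card : ℝ) ≤ (2 * R / s + 1) ^ Module.finrank ℝ E := by
  let _ : MeasurableSpace E := borel E
  have : BorelSpace E := ⟨rfl⟩
  set d := Module.finrank ℝ E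
  set μ : Measure E := Measure.addHaar
  have hdisj : Set.PairwiseDisjoint (F : Set E) (fun z => Metric.ball z (s / 2)) := by
    intro z hz w hw hzw
    exact Metric.ball_disjoint_ball (by linarith [hsep z hz w hw hzw])
  have hsub : (⋃ z ∈ F, Metric.ball z (s / 2)) ⊆ Metric.ball c (R + s / 2) := by
    intro u hu
    simp only [Set.mem_iUnion, Metric.mem_ball, exists_prop] at hu ⊢
    obtain ⟨z, hz, hu⟩ := hu
    linarith [dist_triangle u z c, hball z hz]
  have h1 := measure_mono (μ := μ) hsub
  rw [measure_biUnion_finset hdisj (fun z _ => measurableSet_ball)] at h1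
  simp_rw [Measure.addHaar_ball μ _ (show (0 : ℝ) ≤ s / 2 by linarith)] at h1
  rw [Measure.addHaar_ball μ _ (show (0 : ℝ) ≤ R + s / 2 by linarith), Finset.sum_const,
    nsmul_eq_mul, ← mul_assoc] at h1
  have hpos : μ (Metric.ball 0 1) ≠ 0 := (Metric.measure_ball_pos μ _ one_pos).ne'
  have hfin : μ (Metric.ball 0 1) ≠ ⊤ := measure_ball_lt_top.ne
  rw [ENNReal.mul_le_mul_iff_left hpos hfin, ← ENNReal.ofReal_natCast, ← ENNReal.ofReal_mul
    (by positivity), ENNReal.ofReal_le_ofReal_iff (by positivity)] at h1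
  have h2 : (R + s / 2) ^ d = (2 * R / s + 1) ^ d * (s / 2) ^ d := by
    rw [← mul_pow]
    congr 1
    field_simp
  rw [h2] at h1
  exact le_of_mul_le_mul_right h1 (by positivity)

/-- A positive real number that is at least `t₀`, within `C / r` of `1/8 + ℤ/2`, and at distance at
least `δ` from `ℤ/2`. -/
structure IsNearShiftedHalfInteger (t₀ C δ r : ℝ) : Prop where
  le : t₀ ≤ r
  approx : ∃ n : ℤ, |r - 1 / 8 - n / 2| ≤ C / r
  gap : ∀ n : ℤ, δ ≤ |r - n / 2|

theorem triangle_excess_ge {t₀ C δ M a b c : ℝ} (hC : 0 < C) (hM : 48 * C ≤ M)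
    (ha : IsNearShiftedHalfInteger t₀ C δ a) (hb : IsNearShiftedHalfInteger t₀ C δ b)
    (hc : IsNearShiftedHalfInteger t₀ C δ c) (hMa : M ≤ a) (hMb : M ≤ b) (hMc : M ≤ c)
    (htri : c ≤ a + b) : 1 / 16 ≤ a + b - c := by
  have hsmall : ∀ r, M ≤ r → C / r ≤ 1 / 48 := by
    intro r hr
    rw [div_le_div_iff₀ (by linarith) (by norm_num)]
    linarith
  obtain ⟨na, hna⟩ := ha.approx
  obtain ⟨nb, hnb⟩ := hb.approx
  obtain ⟨nc, hnc⟩ := hc.approx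
  have h1 := abs_le.1 (hna.trans (hsmall a hMa))
  have h2 := abs_le.1 (hnb.trans (hsmall b hMb))
  have h3 := abs_le.1 (hnc.trans (hsmall c hMc))
  by_contra hlt
  rw [not_le] at hlt
  rcases le_or_gt 0 (na + nb - nc) with hn | hn
  · have : (0 : ℝ) ≤ na + nb - nc := by exact_mod_cast hn
    linarith [h1.1, h2.1, h3.2]
  · have hn' : na + nb - nc ≤ -1 := by omega
    have : (na + nb - nc : ℝ) ≤ -1 := by exact_mod_cast hn'
    linarith [h1.2, h2.2, h3.1]

set_option maxHeartbeats 600000 in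
theorem hyperbola_offset_sq_le {t₀ C δ t d D s x y σ : ℝ} (ht₀ : 0 < t₀) (hC : 0 < C) (hδ : 0 < δ)
    (ht : t₀ ≤ t) (hd : |d| ≤ t) (hD : |D| ≤ t - δ) (hdD : s * |d - D| ≤ 8 * C) (hs : 2 * t ≤ s)
    (hs3 : 1024 * t ^ 3 ≤ s ^ 2) (hx : 2 * t * x = s * d)
    (hy : 4 * t ^ 2 * y ^ 2 = (s ^ 2 - t ^ 2) * (t ^ 2 - d ^ 2)) (hy0 : 0 ≤ y) (hσ0 : 0 ≤ σ)
    (hσ : (D / t) ^ 2 + σ ^ 2 = 1) :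
    (D / t * y - σ * x) ^ 2 ≤ 2 * (4 * C / t₀ + 16 * C / √(δ * t₀)) ^ 2 + t / 2048 := by
  have htp : 0 < t := ht₀.trans_le ht
  have hsp : 0 < s := by linarith
  set q := √(δ * t₀) with hq
  have hqp : 0 < q := Real.sqrt_pos.2 (by positivity)
  have hq2 : q ^ 2 = δ * t₀ := Real.sq_sqrt (by positivity)
  have hσ1 : σ ≤ 1 := by nlinarith [sq_nonneg (D / t)]
  have hc1 : |D / t| ≤ 1 := by
    rw [abs_div, abs_of_pos htp, div_le_one htp]; linarith
  have htσ : (t * σ) ^ 2 = t ^ 2 - D ^ 2 := by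
    have : D ^ 2 = (D / t) ^ 2 * t ^ 2 := by field_simp
    rw [this]; linear_combination t ^ 2 * hσ
  have hqt : q ≤ t * σ := by
    refine le_of_sq_le_sq ?_ (by positivity)
    rw [htσ, hq2, ← sq_abs D]
    nlinarith [abs_nonneg D]
  have hσp : 0 < σ := by
    by_contra h
    have : σ = 0 := le_antisymm (not_lt.1 h) hσ0
    rw [this] at hqt
    linarith
  set e := y - s * σ / 2 with he
  have hdD2 : s * |D ^ 2 - d ^ 2| ≤ 16 * C * t := by
    have e1 : |D ^ 2 - d ^ 2| = |d - D| * |d + D| := by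
      rw [← abs_mul, ← abs_neg]; congr 1; ring
    have e2 : |d + D| ≤ 2 * t := (abs_add_le _ _).trans (by linarith)
    rw [e1, ← mul_assoc]
    calc s * |d - D| * |d + D| ≤ 8 * C * (2 * t) := by gcongr
      _ = 16 * C * t := by ring
  have hprod : 4 * t ^ 2 * (e * (y + s * σ / 2)) =
      s ^ 2 * (D ^ 2 - d ^ 2) - t ^ 2 * ((t * σ) ^ 2 + (D ^ 2 - d ^ 2)) := by
    rw [he]
    linear_combination hy - (s ^ 2 - t ^ 2) * htσ
  have hprod' : 4 * t ^ 2 * (|e| * (s * σ / 2)) ≤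
      s * (16 * C * t) + t ^ 2 * (t * σ) ^ 2 + t * (16 * C * t) := by
    have h1 : 4 * t ^ 2 * (|e| * (s * σ / 2)) ≤ |4 * t ^ 2 * (e * (y + s * σ / 2))| := by
      rw [abs_mul (4 * t ^ 2), abs_mul e, abs_of_nonneg (show 0 ≤ 4 * t ^ 2 by positivity),
        abs_of_nonneg (show 0 ≤ y + s * σ / 2 by positivity)]
      gcongr
      linarith
    refine h1.trans ?_
    rw [hprod]
    have h2 : |s ^ 2 * (D ^ 2 - d ^ 2)| ≤ s * (16 * C * t) := by
      rw [abs_mul, abs_of_nonneg (sq_nonneg s), pow_two, mul_assoc]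
      gcongr
    have h3 : t ^ 2 * |D ^ 2 - d ^ 2| ≤ t * (16 * C * t) := by
      rw [pow_two, mul_assoc]
      refine mul_le_mul_of_nonneg_left (le_trans ?_ hdD2) htp.le
      gcongr
      linarith
    have h4 : |t ^ 2 * ((t * σ) ^ 2 + (D ^ 2 - d ^ 2))| ≤
        t ^ 2 * (t * σ) ^ 2 + t ^ 2 * |D ^ 2 - d ^ 2| := by
      rw [abs_mul, abs_of_nonneg (sq_nonneg t), ← mul_add]
      gcongr
      refine (abs_add_le _ _).trans ?_
      rw [abs_of_nonneg (sq_nonneg (t * σ))]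
    refine (abs_sub _ _).trans ?_
    linarith
  have hebound : |e| ≤ 16 * C / q + t ^ 2 / (2 * s) := by
    have h1 : |e| ≤ 16 * C / (t * σ) + t ^ 2 * σ / (2 * s) := by
      have h2 : t * (16 * C * t) ≤ s * (16 * C * t) := by gcongr; linarith
      have h3 : 2 * t ^ 2 * s * σ * |e| ≤
          2 * t ^ 2 * s * σ * (16 * C / (t * σ) + t ^ 2 * σ / (2 * s)) := by
        have : 2 * t ^ 2 * s * σ * (16 * C / (t * σ) + t ^ 2 * σ / (2 * s)) =
            2 * (s * (16 * C * t)) + t ^ 2 * (t * σ) ^ 2 := by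
          field_simp
        rw [this]
        linarith
      exact le_of_mul_le_mul_left h3 (by positivity)
    refine h1.trans ?_
    gcongr
    nlinarith [sq_nonneg t]
  have hmain : |D / t * y - σ * x| ≤ (4 * C / t₀ + 16 * C / q) + t ^ 2 / (2 * s) := by
    have h1 : D / t * y - σ * x = D / t * e - σ * (s * (d - D) / (2 * t)) := by
      have hx' : x = s * d / (2 * t) := by field_simp; linarith
      rw [he, hx']
      field_simp
      ring
    have h2 : |σ * (s * (d - D) / (2 * t))| ≤ 4 * C / t₀ := by
      rw [abs_mul, abs_div, abs_mul, abs_of_pos hσp, abs_of_pos hsp,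
        abs_of_pos (show 0 < 2 * t by positivity)]
      calc σ * (s * |d - D| / (2 * t)) ≤ 1 * (8 * C / (2 * t₀)) := by gcongr
        _ = 4 * C / t₀ := by ring
    have h3 : |D / t * e| ≤ 16 * C / q + t ^ 2 / (2 * s) := by
      rw [abs_mul]
      calc |D / t| * |e| ≤ 1 * |e| := by gcongr
        _ ≤ _ := by rw [one_mul]; exact hebound
    rw [h1]
    refine (abs_sub _ _).trans ?_
    linarith
  set A := 4 * C / t₀ + 16 * C / q with hA
  have hB : (t ^ 2 / (2 * s)) ^ 2 ≤ t / 4096 := by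
    rw [div_pow, div_le_div_iff₀ (by positivity) (by norm_num)]
    have := mul_le_mul_of_nonneg_left hs3 htp.le
    linarith
  rw [← sq_abs]
  have hA0 : 0 ≤ A := by positivity
  have hB0 : 0 ≤ t ^ 2 / (2 * s) := by positivity
  have : |D / t * y - σ * x| ^ 2 ≤ (A + t ^ 2 / (2 * s)) ^ 2 := by gcongr
  nlinarith [sq_nonneg (A - t ^ 2 / (2 * s))]

/-- The coordinate of `z` along the unit vector `(c, σ)`. -/
def alongCoord (c σ : ℝ) (z : ℂ) : ℝ := c * z.re + σ * z.im

/-- The coordinate of `z` orthogonal to the unit vector `(c, σ)`. -/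
def acrossCoord (c σ : ℝ) (z : ℂ) : ℝ := c * z.im - σ * z.re

theorem dist_sq_eq_coords {c σ : ℝ} (h : c ^ 2 + σ ^ 2 = 1) (z w : ℂ) :
    dist z w ^ 2 = (alongCoord c σ z - alongCoord c σ w) ^ 2 +
      (acrossCoord c σ z - acrossCoord c σ w) ^ 2 := by
  rw [Complex.dist_eq, Complex.sq_norm, Complex.normSq_apply, alongCoord, alongCoord, acrossCoord,
    acrossCoord, Complex.sub_re, Complex.sub_im]
  linear_combination (-(z.re - w.re) ^ 2 - (z.im - w.im) ^ 2) * h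

theorem dist_le_along_add {c σ m Q : ℝ} (h : c ^ 2 + σ ^ 2 = 1) (hm : 0 < m) (hQ : 256 * Q ≤ m)
    {z w : ℂ} (hz : acrossCoord c σ z ^ 2 ≤ Q) (hw : acrossCoord c σ w ^ 2 ≤ Q)
    (hzw : m ≤ dist z w) :
    dist z w ≤ |alongCoord c σ z - alongCoord c σ w| + 1 / 64 := by
  have h1 := dist_sq_eq_coords h z w
  set p := alongCoord c σ z - alongCoord c σ w
  set u := acrossCoord c σ z
  set v := acrossCoord c σ w
  have h2 : (u - v) ^ 2 ≤ dist z w / 64 := by nlinarith [sq_nonneg (u + v)]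
  have h3 : |p| ≤ dist z w := by
    refine le_of_sq_le_sq ?_ dist_nonneg
    rw [sq_abs]
    nlinarith [sq_nonneg (u - v)]
  have h4 : dist z w * (dist z w - |p|) ≤ dist z w * (1 / 64) := by
    nlinarith [sq_abs p, abs_nonneg p]
  have := le_of_mul_le_mul_left h4 (by linarith)
  linarith

theorem along_le_dist {c σ : ℝ} (h : c ^ 2 + σ ^ 2 = 1) (z w : ℂ) :
    alongCoord c σ w - alongCoord c σ z ≤ dist z w := by
  refine (le_abs_self _).trans (le_of_sq_le_sq ?_ dist_nonneg)
  rw [sq_abs, dist_sq_eq_coords h]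
  nlinarith [sq_nonneg (acrossCoord c σ z - acrossCoord c σ w)]

theorem not_three_far_of_sorted {t₀ C δ M m Q c σ : ℝ} (hC : 0 < C) (hM : 48 * C ≤ M) (hm : M ≤ m)
    (hQ : 256 * Q ≤ m) (h : c ^ 2 + σ ^ 2 = 1) {z₁ z₂ z₃ : ℂ}
    (h₁ : acrossCoord c σ z₁ ^ 2 ≤ Q) (h₂ : acrossCoord c σ z₂ ^ 2 ≤ Q)
    (h₃ : acrossCoord c σ z₃ ^ 2 ≤ Q)
    (g₁₂ : IsNearShiftedHalfInteger t₀ C δ (dist z₁ z₂))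
    (g₂₃ : IsNearShiftedHalfInteger t₀ C δ (dist z₂ z₃))
    (g₁₃ : IsNearShiftedHalfInteger t₀ C δ (dist z₁ z₃))
    (m₁₂ : m ≤ dist z₁ z₂) (m₂₃ : m ≤ dist z₂ z₃) (m₁₃ : m ≤ dist z₁ z₃)
    (o₁₂ : alongCoord c σ z₁ ≤ alongCoord c σ z₂) (o₂₃ : alongCoord c σ z₂ ≤ alongCoord c σ z₃) :
    False := by
  have hmp : 0 < m := by linarith
  have e := triangle_excess_ge hC hM g₁₂ g₂₃ g₁₃ (hm.trans m₁₂) (hm.trans m₂₃) (hm.trans m₁₃)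
    (dist_triangle _ _ _)
  have d₁₂ := dist_le_along_add h hmp hQ h₁ h₂ m₁₂
  have d₂₃ := dist_le_along_add h hmp hQ h₂ h₃ m₂₃
  have d₁₃ := along_le_dist h z₁ z₃
  rw [abs_of_nonpos (by linarith)] at d₁₂ d₂₃
  linarith

theorem not_three_far {t₀ C δ M m Q c σ : ℝ} (hC : 0 < C) (hM : 48 * C ≤ M) (hm : M ≤ m)
    (hQ : 256 * Q ≤ m) (h : c ^ 2 + σ ^ 2 = 1) {z₁ z₂ z₃ : ℂ}
    (h₁ : acrossCoord c σ z₁ ^ 2 ≤ Q) (h₂ : acrossCoord c σ z₂ ^ 2 ≤ Q)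
    (h₃ : acrossCoord c σ z₃ ^ 2 ≤ Q)
    (g₁₂ : IsNearShiftedHalfInteger t₀ C δ (dist z₁ z₂))
    (g₂₃ : IsNearShiftedHalfInteger t₀ C δ (dist z₂ z₃))
    (g₁₃ : IsNearShiftedHalfInteger t₀ C δ (dist z₁ z₃))
    (m₁₂ : m ≤ dist z₁ z₂) (m₂₃ : m ≤ dist z₂ z₃) (m₁₃ : m ≤ dist z₁ z₃) :
    False := by
  have g₂₁ := g₁₂
  have g₃₂ := g₂₃
  have g₃₁ := g₁₃
  have m₂₁ := m₁₂
  have m₃₂ := m₂₃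
  have m₃₁ := m₁₃
  rw [dist_comm] at g₂₁ g₃₂ g₃₁ m₂₁ m₃₂ m₃₁
  rcases le_total (alongCoord c σ z₁) (alongCoord c σ z₂) with o₁₂ | o₁₂ <;>
  rcases le_total (alongCoord c σ z₂) (alongCoord c σ z₃) with o₂₃ | o₂₃ <;>
  rcases le_total (alongCoord c σ z₁) (alongCoord c σ z₃) with o₁₃ | o₁₃
  · exact not_three_far_of_sorted hC hM hm hQ h h₁ h₂ h₃ g₁₂ g₂₃ g₁₃ m₁₂ m₂₃ m₁₃ o₁₂ o₂₃
  · exact not_three_far_of_sorted hC hM hm hQ h h₁ h₂ h₃ g₁₂ g₂₃ g₁₃ m₁₂ m₂₃ m₁₃ o₁₂ o₂₃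
  · exact not_three_far_of_sorted hC hM hm hQ h h₁ h₃ h₂ g₁₃ g₃₂ g₁₂ m₁₃ m₃₂ m₁₂ o₁₃ o₂₃
  · exact not_three_far_of_sorted hC hM hm hQ h h₃ h₁ h₂ g₃₁ g₁₂ g₃₂ m₃₁ m₁₂ m₃₂ o₁₃ o₁₂
  · exact not_three_far_of_sorted hC hM hm hQ h h₂ h₁ h₃ g₂₁ g₁₃ g₂₃ m₂₁ m₁₃ m₂₃ o₁₂ o₁₃
  · exact not_three_far_of_sorted hC hM hm hQ h h₂ h₃ h₁ g₂₃ g₃₁ g₂₁ m₂₃ m₃₁ m₂₁ o₂₃ o₁₃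
  · exact not_three_far_of_sorted hC hM hm hQ h h₃ h₂ h₁ g₃₂ g₂₁ g₃₁ m₃₂ m₂₁ m₃₁ o₂₃ o₁₂
  · exact not_three_far_of_sorted hC hM hm hQ h h₃ h₂ h₁ g₃₂ g₂₁ g₃₁ m₃₂ m₂₁ m₃₁ o₂₃ o₁₂

theorem card_le_of_no_three_far {F : Finset ℂ} {t₀ M : ℝ} (ht₀ : 0 < t₀) (hM : 0 < M)
    (hsep : ∀ z ∈ F, ∀ w ∈ F, z ≠ w → t₀ ≤ dist z w)
    (hno : ∀ z₁ ∈ F, ∀ z₂ ∈ F, ∀ z₃ ∈ F, M ≤ dist z₁ z₂ → M ≤ dist z₂ z₃ → M ≤ dist z₁ z₃ → False) :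
    (F.card : ℝ) ≤ 2 * (2 * M / t₀ + 1) ^ 2 := by
  classical
  have hball : ∀ z : ℂ, ((F.filter fun w => dist w z ≤ M).card : ℝ) ≤ (2 * M / t₀ + 1) ^ 2 := by
    intro z
    have := card_le_of_separated (F.filter fun w => dist w z ≤ M) z hM.le ht₀
      (fun w hw => (Finset.mem_filter.1 hw).2)
      (fun u hu w hw => hsep u (Finset.mem_filter.1 hu).1 w (Finset.mem_filter.1 hw).1)
    rwa [Complex.finrank_real_complex] at this
  by_cases h : ∃ z₁ ∈ F, ∃ z₂ ∈ F, M < dist z₁ z₂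
  · obtain ⟨z₁, h₁, z₂, h₂, h₁₂⟩ := h
    have hsub : F ⊆ (F.filter fun w => dist w z₁ ≤ M) ∪ (F.filter fun w => dist w z₂ ≤ M) := by
      intro w hw
      rw [Finset.mem_union, Finset.mem_filter, Finset.mem_filter]
      by_contra hcon
      rw [not_or, not_and, not_and, not_le, not_le] at hcon
      exact hno z₁ h₁ z₂ h₂ w hw h₁₂.le (by rw [dist_comm]; exact (hcon.2 hw).le)
        (by rw [dist_comm]; exact (hcon.1 hw).le)
    have hc : (F.card : ℝ) ≤ ((F.filter fun w => dist w z₁ ≤ M).card : ℝ) +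
        ((F.filter fun w => dist w z₂ ≤ M).card : ℝ) := by
      exact_mod_cast (Finset.card_le_card hsub).trans (Finset.card_union_le _ _)
    linarith [hball z₁, hball z₂]
  · push Not at h
    rcases F.eq_empty_or_nonempty with rfl | ⟨z, hz⟩
    · simp
      positivity
    · have := hball z
      rw [Finset.filter_true_of_mem (fun w hw => h w hw z hz)] at this
      nlinarith [sq_nonneg (2 * M / t₀ + 1)]

theorem exists_hyperbola_index {t₀ C δ t a b : ℝ} (hC : 0 < C)
    (ht : IsNearShiftedHalfInteger t₀ C δ t) (ha : IsNearShiftedHalfInteger t₀ C δ a)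
    (hb : IsNearShiftedHalfInteger t₀ C δ b) (hab : |a - b| ≤ t) (hs : 2 * t ≤ a + b)
    (hs0 : 0 < a + b) (hsδ : 8 * C < δ * (a + b)) :
    ∃ k : ℤ, |(k / 2 : ℝ)| ≤ t - δ ∧ (a + b) * |a - b - k / 2| ≤ 8 * C := by
  obtain ⟨n, hn⟩ := ha.approx
  obtain ⟨l, hl⟩ := hb.approx
  have hab' := abs_le.1 hab
  have h1 : C / a ≤ C / ((a + b) / 4) := by
    gcongr; linarith [hab'.1]
  have h2 : C / b ≤ C / ((a + b) / 4) := by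
    gcongr; linarith [hab'.2]
  have h3 : C / ((a + b) / 4) = 4 * C / (a + b) := by field_simp
  have h4 : |a - b - ((n - l : ℤ) : ℝ) / 2| ≤ 8 * C / (a + b) := by
    have e : a - b - ((n - l : ℤ) : ℝ) / 2 = (a - 1 / 8 - n / 2) - (b - 1 / 8 - l / 2) := by
      push_cast; ring
    rw [e]
    refine (abs_sub _ _).trans ?_
    have : 8 * C / (a + b) = 4 * C / (a + b) + 4 * C / (a + b) := by ring
    linarith
  have h5 : 8 * C / (a + b) < δ := by
    rw [div_lt_iff₀ hs0]; exact hsδ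
  refine ⟨n - l, ?_, ?_⟩
  · have h6 := abs_le.1 h4
    have h7 := ht.gap (n - l)
    have h8 := ht.gap (-(n - l))
    push_cast at h6 h7 h8 ⊢
    rw [abs_le]
    constructor
    · rcases le_abs.1 h8 with h | h <;> linarith [h6.1, h6.2]
    · rcases le_abs.1 h7 with h | h <;> linarith [h6.1, h6.2]
  · rw [le_div_iff₀ hs0] at h4
    linarith

theorem elliptic_coords (t : ℝ) (z : ℂ) :
    2 * t * z.re = (‖z + t / 2‖ + ‖z - t / 2‖) * (‖z + t / 2‖ - ‖z - t / 2‖) ∧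
    4 * t ^ 2 * z.im ^ 2 = ((‖z + t / 2‖ + ‖z - t / 2‖) ^ 2 - t ^ 2) *
      (t ^ 2 - (‖z + t / 2‖ - ‖z - t / 2‖) ^ 2) := by
  have ha : ‖z + t / 2‖ ^ 2 = (z.re + t / 2) ^ 2 + z.im ^ 2 := by
    have e : z + t / 2 = z + ((t / 2 : ℝ) : ℂ) := by push_cast; ring
    rw [e, Complex.sq_norm, Complex.normSq_apply, Complex.add_re, Complex.add_im,
      Complex.ofReal_re, Complex.ofReal_im]
    ring
  have hb : ‖z - t / 2‖ ^ 2 = (z.re - t / 2) ^ 2 + z.im ^ 2 := by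
    have e : z - t / 2 = z - ((t / 2 : ℝ) : ℂ) := by push_cast; ring
    rw [e, Complex.sq_norm, Complex.normSq_apply, Complex.sub_re, Complex.sub_im,
      Complex.ofReal_re, Complex.ofReal_im]
    ring
  set a := ‖z + t / 2‖
  set b := ‖z - t / 2‖
  have h1 : 2 * t * z.re = (a + b) * (a - b) := by linear_combination -ha + hb
  refine ⟨h1, ?_⟩
  have h2 : ((a + b) * (a - b)) ^ 2 = 4 * t ^ 2 * z.re ^ 2 := by rw [← h1]; ring
  have h3 : (a + b) ^ 2 + (a - b) ^ 2 = 4 * z.re ^ 2 + t ^ 2 + 4 * z.im ^ 2 := by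
    linear_combination 2 * ha + 2 * hb
  linear_combination h2 - t ^ 2 * h3

theorem card_hyperbola_class_le {t₀ C δ M t : ℝ} (ht₀ : 0 < t₀) (hC : 0 < C) (hδ : 0 < δ)
    (hM : 48 * C ≤ M) (hM' : 1024 * (4 * C / t₀ + 16 * C / √(δ * t₀)) ^ 2 ≤ M) (ht : t₀ ≤ t)
    {F : Finset ℂ} (hgood : ∀ z ∈ F, ∀ w ∈ F, z ≠ w → IsNearShiftedHalfInteger t₀ C δ (dist z w))
    (hsep : ∀ z ∈ F, ∀ w ∈ F, z ≠ w → t / 2 ≤ dist z w) {D : ℝ} (hD : |D| ≤ t - δ) {ε : ℝ}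
    (hε : ε ^ 2 = 1)
    (hfar : ∀ z ∈ F, 0 ≤ ε * z.im ∧ 2 * t ≤ ‖z + t / 2‖ + ‖z - t / 2‖ ∧
      1024 * t ^ 3 ≤ (‖z + t / 2‖ + ‖z - t / 2‖) ^ 2 ∧ |‖z + t / 2‖ - ‖z - t / 2‖| ≤ t ∧
      (‖z + t / 2‖ + ‖z - t / 2‖) * |‖z + t / 2‖ - ‖z - t / 2‖ - D| ≤ 8 * C) :
    (F.card : ℝ) ≤ 2 * (2 * M / t₀ + 1) ^ 2 := by
  have htp : 0 < t := ht₀.trans_le ht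
  have hMp : 0 < M := by linarith
  have hc1 : (D / t) ^ 2 ≤ 1 := by
    rw [← sq_abs, abs_div, abs_of_pos htp]
    exact pow_le_one₀ (by positivity) (by rw [div_le_one htp]; linarith)
  set σ := √(1 - (D / t) ^ 2) with hσ
  have hσ2 : (D / t) ^ 2 + σ ^ 2 = 1 := by
    rw [hσ, Real.sq_sqrt (by linarith)]; ring
  have hunit : (D / t) ^ 2 + (ε * σ) ^ 2 = 1 := by
    rw [mul_pow, hε, one_mul, hσ2]
  have hacross : ∀ z ∈ F, acrossCoord (D / t) (ε * σ) z ^ 2 ≤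
      2 * (4 * C / t₀ + 16 * C / √(δ * t₀)) ^ 2 + t / 2048 := by
    intro z hz
    obtain ⟨h1, h2, h3, h4, h5⟩ := hfar z hz
    obtain ⟨hx, hy⟩ := elliptic_coords t z
    have := hyperbola_offset_sq_le ht₀ hC hδ ht h4 hD h5 h2 h3 hx
      (y := ε * z.im) (by rw [mul_pow, hε, one_mul]; exact hy) h1 (Real.sqrt_nonneg _) hσ2
    refine le_trans (le_of_eq ?_) this
    have e : D / t * (ε * z.im) - σ * z.re = ε * acrossCoord (D / t) (ε * σ) z := by
      rw [acrossCoord]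
      linear_combination (σ * z.re) * hε
    rw [← hσ, e, mul_pow, hε, one_mul]
  refine card_le_of_no_three_far ht₀ hMp (fun z hz w hw hzw => (hgood z hz w hw hzw).le) ?_
  intro z₁ h₁ z₂ h₂ z₃ h₃ m₁₂ m₂₃ m₁₃
  have hne : ∀ {z w : ℂ}, M ≤ dist z w → z ≠ w := by
    rintro z w h rfl
    rw [dist_self] at h
    linarith
  refine not_three_far (m := max M (t / 2)) hC hM (le_max_left _ _) ?_ hunit (hacross z₁ h₁)
    (hacross z₂ h₂) (hacross z₃ h₃) (hgood _ h₁ _ h₂ (hne m₁₂)) (hgood _ h₂ _ h₃ (hne m₂₃))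
    (hgood _ h₁ _ h₃ (hne m₁₃)) (max_le m₁₂ (hsep _ h₁ _ h₂ (hne m₁₂)))
    (max_le m₂₃ (hsep _ h₂ _ h₃ (hne m₂₃))) (max_le m₁₃ (hsep _ h₁ _ h₃ (hne m₁₃)))
  linarith [le_max_left M (t / 2), le_max_right M (t / 2)]

theorem card_far_le {t₀ C δ M t : ℝ} (ht₀ : 0 < t₀) (hC : 0 < C) (hδ : 0 < δ)
    (hM : 48 * C ≤ M) (hM' : 1024 * (4 * C / t₀ + 16 * C / √(δ * t₀)) ^ 2 ≤ M)
    (ht : IsNearShiftedHalfInteger t₀ C δ t) {F : Finset ℂ}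
    (hgood : ∀ z ∈ F, ∀ w ∈ F, z ≠ w → IsNearShiftedHalfInteger t₀ C δ (dist z w))
    (hsep : ∀ z ∈ F, ∀ w ∈ F, z ≠ w → t / 2 ≤ dist z w)
    (hfoci : ∀ z ∈ F, IsNearShiftedHalfInteger t₀ C δ ‖z + t / 2‖ ∧
      IsNearShiftedHalfInteger t₀ C δ ‖z - t / 2‖)
    (hfar : ∀ z ∈ F, 2 * t ≤ ‖z + t / 2‖ + ‖z - t / 2‖ ∧
      1024 * t ^ 3 ≤ (‖z + t / 2‖ + ‖z - t / 2‖) ^ 2 ∧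
      8 * C < δ * (‖z + t / 2‖ + ‖z - t / 2‖)) :
    (F.card : ℝ) ≤ 2 * (2 * M / t₀ + 1) ^ 2 * ((8 + 2 / t₀) * t) := by
  classical
  have htp : 0 < t := ht₀.trans_le ht.le
  have hd : ∀ z : ℂ, |‖z + t / 2‖ - ‖z - t / 2‖| ≤ t := by
    intro z
    refine (abs_norm_sub_norm_le _ _).trans (le_of_eq ?_)
    have e : z + t / 2 - (z - t / 2) = (t : ℂ) := by ring
    rw [e, Complex.norm_real, Real.norm_of_nonneg htp.le]
  have hk : ∀ z : ℂ, ∃ k : ℤ, z ∈ F → |(k / 2 : ℝ)| ≤ t - δ ∧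
      (‖z + t / 2‖ + ‖z - t / 2‖) * |‖z + t / 2‖ - ‖z - t / 2‖ - k / 2| ≤ 8 * C := by
    intro z
    by_cases hz : z ∈ F
    · obtain ⟨h1, h2, h3⟩ := hfar z hz
      obtain ⟨k, h⟩ := exists_hyperbola_index hC ht (hfoci z hz).1 (hfoci z hz).2 (hd z) h1
        (by linarith) h3
      exact ⟨k, fun _ => h⟩
    · exact ⟨0, fun h => absurd h hz⟩
  choose k hk using hk
  set N : ℤ := ⌊2 * t⌋ with hN
  set T : Finset (ℤ × Bool) := Finset.Icc (-N) N ×ˢ Finset.univ with hT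
  have hmaps : ∀ z ∈ F, (k z, decide (0 ≤ z.im)) ∈ T := by
    intro z hz
    have h := abs_le.1 (hk z hz).1
    rw [hT, Finset.mem_product, Finset.mem_Icc]
    refine ⟨⟨?_, ?_⟩, Finset.mem_univ _⟩
    · rw [neg_le, hN, Int.le_floor]
      push_cast
      linarith [h.1]
    · rw [hN, Int.le_floor]
      linarith [h.2]
  have hMp : 0 < M := by linarith
  have hfib : ∀ b ∈ T, (F.filter fun z => (k z, decide (0 ≤ z.im)) = b).card ≤
      ⌊2 * (2 * M / t₀ + 1) ^ 2⌋₊ := by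
    rintro ⟨j, b⟩ -
    rw [Nat.le_floor_iff (by positivity)]
    set G := F.filter fun z => (k z, decide (0 ≤ z.im)) = (j, b) with hG
    have hGF : ∀ z ∈ G, z ∈ F ∧ k z = j ∧ decide (0 ≤ z.im) = b := by
      intro z hz
      rw [hG, Finset.mem_filter, Prod.mk.injEq] at hz
      exact hz
    rcases G.eq_empty_or_nonempty with hGe | ⟨w, hw⟩
    · rw [hGe, Finset.card_empty, Nat.cast_zero]
      positivity
    refine card_hyperbola_class_le (D := (j / 2 : ℝ)) (ε := if b then 1 else -1) ht₀ hC hδ hM hM'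
      ht.le (fun z hz w hw => hgood z (hGF z hz).1 w (hGF w hw).1)
      (fun z hz w hw => hsep z (hGF z hz).1 w (hGF w hw).1) ?_ ?_ ?_
    · obtain ⟨hwF, hwk, -⟩ := hGF w hw
      rw [← hwk]
      exact (hk w hwF).1
    · split_ifs <;> norm_num
    · intro z hz
      obtain ⟨hzF, hzk, hzb⟩ := hGF z hz
      obtain ⟨h1, h2, -⟩ := hfar z hzF
      refine ⟨?_, h1, h2, hd z, ?_⟩
      · rw [← hzb]
        by_cases him : 0 ≤ z.im
        · simp [him]
        · simp only [him, decide_false, Bool.false_eq_true, if_false]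
          linarith
      · rw [← hzk]
        exact (hk z hzF).2
  have hcard := Finset.card_le_mul_card_image_of_maps_to hmaps _ hfib
  have hTcard : (T.card : ℝ) ≤ (8 + 2 / t₀) * t := by
    have hN0 : 0 ≤ N := by rw [hN]; positivity
    have e : ((Finset.Icc (-N) N).card : ℝ) = 2 * N + 1 := by
      rw [Int.card_Icc]
      have : ((N + 1 - -N).toNat : ℤ) = 2 * N + 1 := by
        rw [Int.toNat_of_nonneg (by linarith)]; ring
      exact_mod_cast this
    rw [hT, Finset.card_product, Nat.cast_mul, e]
    have h1 : (N : ℝ) ≤ 2 * t := Int.floor_le _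
    have h2 : 1 ≤ t / t₀ := (one_le_div ht₀).2 ht.le
    have h3 : (8 + 2 / t₀) * t = 8 * t + 2 * (t / t₀) := by ring
    rw [h3]
    simp
    linarith
  calc (F.card : ℝ) ≤ (⌊2 * (2 * M / t₀ + 1) ^ 2⌋₊ : ℝ) * T.card := by exact_mod_cast hcard
    _ ≤ _ := by
      gcongr
      exact Nat.floor_le (by positivity)

theorem exists_card_le_mul {t₀ C δ : ℝ} (ht₀ : 0 < t₀) (hC : 0 < C) (hδ : 0 < δ) :
    ∃ K : ℝ, 0 < K ∧ ∀ (F : Finset ℂ) (t : ℝ), 0 < t → (t / 2 : ℂ) ∈ F → (-(t / 2) : ℂ) ∈ F →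
      (∀ z ∈ F, ∀ w ∈ F, z ≠ w → IsNearShiftedHalfInteger t₀ C δ (dist z w)) →
      (∀ z ∈ F, ∀ w ∈ F, z ≠ w → t / 2 ≤ dist z w) → (F.card : ℝ) ≤ K * t := by
  classical
  set M := 48 * C + 1024 * (4 * C / t₀ + 16 * C / √(δ * t₀)) ^ 2 with hM
  set B := 5 + 18 * C / (δ * t₀) with hB
  have hMp : 0 < M := by positivity
  refine ⟨(8192 + 2 * B ^ 2 / t₀) + 2 * (2 * M / t₀ + 1) ^ 2 * (8 + 2 / t₀), by positivity, ?_⟩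
  intro F t htp hp hq hgood hsep
  have hpq : dist (t / 2 : ℂ) (-(t / 2)) = t := by
    rw [Complex.dist_eq, show (t / 2 : ℂ) - -(t / 2) = (t : ℂ) by ring, Complex.norm_real,
      Real.norm_of_nonneg htp.le]
  have ht : IsNearShiftedHalfInteger t₀ C δ t := by
    have := hgood _ hp _ hq (by rw [← dist_pos, hpq]; exact htp)
    rwa [hpq] at this
  set ρ := 32 * t * √t + 2 * t + 9 * C / δ with hρ
  have hρp : 0 < ρ := by positivity
  set s : ℂ → ℝ := fun z => ‖z + t / 2‖ + ‖z - t / 2‖ with hs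
  have hnear : ((F.filter fun z => s z < ρ).card : ℝ) ≤ (8192 + 2 * B ^ 2 / t₀) * t := by
    have h := card_le_of_separated (F.filter fun z => s z < ρ) 0 (R := ρ / 2) (s := t / 2)
      (by positivity) (by positivity)
      (fun z hz => by
        have h1 := (Finset.mem_filter.1 hz).2
        have h2 : ‖z + z‖ ≤ s z := by
          have : z + z = (z + t / 2) + (z - t / 2) := by ring
          rw [this]
          exact norm_add_le _ _
        rw [← two_mul, norm_mul, Complex.norm_ofNat] at h2
        rw [dist_zero_right]
        linarith)
      (fun u hu w hw => hsep u (Finset.mem_filter.1 hu).1 w (Finset.mem_filter.1 hw).1)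
    rw [Complex.finrank_real_complex] at h
    refine h.trans ?_
    have hb : 2 * (ρ / 2) / (t / 2) + 1 ≤ 64 * √t + B := by
      have e : 2 * (ρ / 2) / (t / 2) + 1 = 64 * √t + 5 + 18 * C / (δ * t) := by
        rw [hρ]; field_simp; ring
      have : 18 * C / (δ * t) ≤ 18 * C / (δ * t₀) := by
        gcongr; exact ht.le
      rw [e, hB]
      linarith
    have h0 : 0 ≤ 2 * (ρ / 2) / (t / 2) + 1 := by positivity
    have h2 : 2 * B ^ 2 ≤ 2 * B ^ 2 / t₀ * t := by
      rw [div_mul_eq_mul_div, le_div_iff₀ ht₀]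
      gcongr
      exact ht.le
    calc (2 * (ρ / 2) / (t / 2) + 1) ^ 2 ≤ (64 * √t + B) ^ 2 := by gcongr
      _ ≤ 2 * (64 * √t) ^ 2 + 2 * B ^ 2 := by nlinarith [sq_nonneg (64 * √t - B)]
      _ = 8192 * t + 2 * B ^ 2 := by rw [mul_pow, Real.sq_sqrt htp.le]; ring
      _ ≤ _ := by linarith
  have hfar : ((F.filter fun z => ¬ s z < ρ).card : ℝ) ≤
      2 * (2 * M / t₀ + 1) ^ 2 * ((8 + 2 / t₀) * t) := by
    have hmem : ∀ z ∈ F.filter (fun z => ¬ s z < ρ), z ∈ F ∧ ρ ≤ s z := fun z hz =>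
      ⟨(Finset.mem_filter.1 hz).1, not_lt.1 (Finset.mem_filter.1 hz).2⟩
    have hst : ∀ z ∈ F.filter (fun z => ¬ s z < ρ), 2 * t ≤ s z := by
      intro z hz
      refine le_trans ?_ (hmem z hz).2
      have : 0 ≤ 32 * t * √t := by positivity
      have : 0 ≤ 9 * C / δ := by positivity
      rw [hρ]; linarith
    refine card_far_le ht₀ hC hδ (by rw [hM]; linarith [sq_nonneg (4 * C / t₀ + 16 * C / √(δ * t₀))])
      (by rw [hM]; linarith) ht
      (fun z hz w hw => hgood z (hmem z hz).1 w (hmem w hw).1)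
      (fun z hz w hw => hsep z (hmem z hz).1 w (hmem w hw).1) (fun z hz => ?_) (fun z hz => ?_)
    · have hzt := hst z hz
      constructor
      · have := hgood z (hmem z hz).1 _ hq (by
          rintro rfl
          rw [hs] at hzt
          simp only [neg_add_cancel, norm_zero, zero_add] at hzt
          rw [show (-(t / 2) - t / 2 : ℂ) = -(t : ℂ) by ring, norm_neg, Complex.norm_real,
            Real.norm_of_nonneg htp.le] at hzt
          linarith)
        rwa [dist_eq_norm, sub_neg_eq_add] at this
      · have := hgood z (hmem z hz).1 _ hp (by
          rintro rfl
          rw [hs] at hzt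
          simp only [sub_self, norm_zero, add_zero] at hzt
          rw [add_halves, Complex.norm_real, Real.norm_of_nonneg htp.le] at hzt
          linarith)
        rwa [dist_eq_norm] at this
    · have hzρ := (hmem z hz).2
      have h9 : 0 < 9 * C / δ := by positivity
      have h32 : 0 ≤ 32 * t * √t := by positivity
      refine ⟨hst z hz, ?_, ?_⟩
      · have e : 1024 * t ^ 3 = (32 * t * √t) ^ 2 := by
          rw [mul_pow, Real.sq_sqrt htp.le]; ring
        rw [e]
        have : 32 * t * √t ≤ s z := by rw [hρ] at hzρ; linarith
        exact pow_le_pow_left₀ h32 this 2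
      · have : 9 * C / δ ≤ s z := by rw [hρ] at hzρ; linarith
        rw [div_le_iff₀ hδ] at this
        change 8 * C < δ * s z
        linarith
  have hsplit := Finset.card_filter_add_card_filter_not (s := F) (fun z => s z < ρ)
  have hsplit' : (F.card : ℝ) = ((F.filter fun z => s z < ρ).card : ℝ) +
      ((F.filter fun z => ¬ s z < ρ).card : ℝ) := by exact_mod_cast hsplit.symm
  rw [hsplit', add_mul, mul_assoc (2 * (2 * M / t₀ + 1) ^ 2)]
  linarith

theorem card_le_of_isometry {E : Type*} [MetricSpace E] {t₀ C δ K t : ℝ}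
    (hK : ∀ (F : Finset ℂ) (t : ℝ), 0 < t → (t / 2 : ℂ) ∈ F → (-(t / 2) : ℂ) ∈ F →
      (∀ z ∈ F, ∀ w ∈ F, z ≠ w → IsNearShiftedHalfInteger t₀ C δ (dist z w)) →
      (∀ z ∈ F, ∀ w ∈ F, z ≠ w → t / 2 ≤ dist z w) → (F.card : ℝ) ≤ K * t)
    {S : Set E} {p q : E} (hp : p ∈ S) (hq : q ∈ S) (ht : 0 < t) {Φ : E → ℂ} (hΦ : Isometry Φ)
    (hΦp : Φ p = -(t / 2)) (hΦq : Φ q = t / 2)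
    (hgood : ∀ z ∈ S, ∀ w ∈ S, z ≠ w → IsNearShiftedHalfInteger t₀ C δ (dist z w))
    (hsep : ∀ z ∈ S, ∀ w ∈ S, z ≠ w → t / 2 ≤ dist z w) (G : Finset E) (hG : (G : Set E) ⊆ S) :
    (G.card : ℝ) ≤ K * t := by
  classical
  set F : Finset ℂ := (insert p (insert q G)).image Φ with hF
  have hmem : ∀ z ∈ F, ∃ x ∈ S, Φ x = z := by
    intro z hz
    obtain ⟨x, hx, rfl⟩ := Finset.mem_image.1 hz
    refine ⟨x, ?_, rfl⟩
    rcases Finset.mem_insert.1 hx with rfl | hx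
    · exact hp
    rcases Finset.mem_insert.1 hx with rfl | hx
    · exact hq
    · exact hG hx
  have hcard : G.card ≤ F.card := by
    rw [hF, Finset.card_image_of_injective _ hΦ.injective]
    exact Finset.card_le_card ((Finset.subset_insert _ _).trans (Finset.subset_insert _ _))
  have hmain := hK F t ht
    (by rw [← hΦq]; exact Finset.mem_image_of_mem _ (by simp))
    (by rw [← hΦp]; exact Finset.mem_image_of_mem _ (by simp))
    (fun z hz w hw hzw => by
      obtain ⟨x, hx, rfl⟩ := hmem z hz
      obtain ⟨y, hy, rfl⟩ := hmem w hw
      rw [hΦ.dist_eq]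
      exact hgood x hx y hy (fun h => hzw (by rw [h])))
    (fun z hz w hw hzw => by
      obtain ⟨x, hx, rfl⟩ := hmem z hz
      obtain ⟨y, hy, rfl⟩ := hmem w hw
      rw [hΦ.dist_eq]
      exact hsep x hx y hy (fun h => hzw (by rw [h])))
  exact le_trans (by exact_mod_cast hcard) hmain

theorem exists_isometry_foci (p q : EuclideanSpace ℝ (Fin 2)) :
    ∃ Φ : EuclideanSpace ℝ (Fin 2) → ℂ, Isometry Φ ∧
      Φ p = -((dist p q : ℝ) / 2) ∧ Φ q = (dist p q : ℝ) / 2 := by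
  obtain ⟨ψ, hψ⟩ := exists_isometry_complex (q - p)
  have hq : ψ.symm (q - p) = (dist p q : ℝ) := by
    rw [dist_comm, dist_eq_norm, ← hψ, LinearIsometryEquiv.symm_apply_apply, hψ]
  refine ⟨fun z => ψ.symm (z - p) - (dist p q : ℝ) / 2, ?_, ?_, ?_⟩
  · refine Isometry.of_dist_eq fun x y => ?_
    rw [dist_sub_right, ψ.symm.dist_map, dist_sub_right]
  · simp
  · simp only [hq]
    ring

theorem Set.finite_and_ncard_le_of_forall_finset {α : Type*} {S : Set α} {B : ℝ}
    (h : ∀ G : Finset α, (G : Set α) ⊆ S → (G.card : ℝ) ≤ B) : S.Finite ∧ (S.ncard : ℝ) ≤ B := by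
  have hfin : S.Finite := by
    by_contra hinf
    obtain ⟨G, hG, hcard⟩ := Set.Infinite.exists_subset_card_eq hinf (⌊B⌋₊ + 1)
    have := h G hG
    rw [hcard] at this
    push_cast at this
    linarith [Nat.lt_floor_add_one B]
  refine ⟨hfin, ?_⟩
  rw [Set.ncard_eq_toFinset_card S hfin]
  exact h _ (by simp)

theorem finrank_plane : Module.finrank ℝ (EuclideanSpace ℝ (Fin 2)) = 2 := by simp

theorem dist_zero_le_of_mem_closedSquare {R : ℝ} (hR : 0 ≤ R) {z : EuclideanSpace ℝ (Fin 2)}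
    (hz : z ∈ closedSquare R) : dist z 0 ≤ 2 * R := by
  rw [dist_zero_right, EuclideanSpace.norm_eq, Real.sqrt_le_left (by linarith), Fin.sum_univ_two,
    Real.norm_eq_abs, Real.norm_eq_abs, sq_abs, sq_abs]
  have h0 := hz 0
  have h1 := hz 1
  nlinarith [h0.1, h0.2, h1.1, h1.2]

theorem card_inter_closedSquare_le {R e : ℝ} (hR : 1 ≤ R) (he : R ^ (2 / 3 : ℝ) ≤ e)
    {G : Finset (EuclideanSpace ℝ (Fin 2))} (hG : ∀ z ∈ G, z ∈ closedSquare R)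
    (hsep : ∀ z ∈ G, ∀ w ∈ G, z ≠ w → e ≤ dist z w) :
    (G.card : ℝ) ≤ 25 * R ^ (2 / 3 : ℝ) := by
  set u := R ^ (1 / 3 : ℝ) with hu
  have hR0 : 0 ≤ R := by linarith
  have hu1 : 1 ≤ u := Real.one_le_rpow hR (by norm_num)
  have hu2 : R ^ (2 / 3 : ℝ) = u ^ 2 := by
    rw [hu, ← Real.rpow_natCast, ← Real.rpow_mul hR0]; norm_num
  have hu3 : R = u ^ 3 := by
    rw [hu, ← Real.rpow_natCast, ← Real.rpow_mul hR0]; norm_num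
  rw [hu2] at he ⊢
  have hep : 0 < e := by nlinarith
  have h := card_le_of_separated G 0 (R := 2 * R) (s := e) (by linarith) hep
    (fun z hz => dist_zero_le_of_mem_closedSquare hR0 (hG z hz)) hsep
  rw [finrank_plane] at h
  refine h.trans ?_
  have h1 : 2 * (2 * R) / e ≤ 4 * u := by
    rw [div_le_iff₀ hep, hu3]
    nlinarith [mul_le_mul_of_nonneg_left he (by linarith : 0 ≤ 4 * u)]
  have h2 : 0 ≤ 2 * (2 * R) / e := by positivity
  calc (2 * (2 * R) / e + 1) ^ 2 ≤ (5 * u) ^ 2 := by gcongr; linarith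
    _ = 25 * u ^ 2 := by ring

theorem IsDiskOrthogonal.semicircleTransform_eq_zero {S : Set (EuclideanSpace ℝ (Fin 2))}
    (hS : IsDiskOrthogonal S) {l m : EuclideanSpace ℝ (Fin 2)} (hl : l ∈ S) (hm : m ∈ S)
    (hlm : l ≠ m) : semicircleTransform (2 * Real.pi * dist l m) = 0 := by
  have h : diskInner (planeExp l) (planeExp m) = 0 := hS hl hm hlm
  rw [diskInner_planeExp] at h
  rw [dist_eq_norm]
  simpa using h

theorem theorem1 :
    ∃ C₁ C₂ : ℝ, 0 < C₁ ∧ 0 < C₂ ∧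
      ∀ S : Set (EuclideanSpace ℝ (Fin 2)), IsDiskOrthogonal S →
        0 < S.einfsep ∧
        ((S.encard : ENat) : ENNReal) ≤ ENNReal.ofReal C₁ * S.einfsep ∧
        ∀ R : ℝ, 1 ≤ R →
          (S ∩ closedSquare R).Finite ∧
          ((S ∩ closedSquare R).ncard : ℝ) ≤ C₂ * R ^ (2 / 3 : ℝ) := by
  obtain ⟨t₀, C, δ, ht₀, hC, hδ, hzero⟩ := exists_zero_constants
  obtain ⟨K, hKpos, hK⟩ := exists_card_le_mul ht₀ hC hδ
  refine ⟨2 * K, 2 * K + 25, by positivity, by positivity, fun S hS => ?_⟩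
  have hgood : ∀ z ∈ S, ∀ w ∈ S, z ≠ w → IsNearShiftedHalfInteger t₀ C δ (dist z w) := by
    intro z hz w hw hzw
    obtain ⟨h1, h2, h3⟩ :=
      hzero _ (dist_pos.2 hzw) (hS.semicircleTransform_eq_zero hz hw hzw)
    exact ⟨h1, h2, h3⟩
  have hpos : 0 < S.einfsep := by
    refine lt_of_lt_of_le (ENNReal.ofReal_pos.2 ht₀) (Set.le_einfsep_of_forall_dist_le ?_)
    exact fun z hz w hw hzw => (hgood z hz w hw hzw).le
  refine ⟨hpos, ?_⟩
  rcases S.subsingleton_or_nontrivial with hsub | hnt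
  · constructor
    · rw [hsub.einfsep, ENNReal.mul_top (ENNReal.ofReal_pos.2 (by positivity)).ne']
      exact le_top
    · intro R hR
      have hfin := hsub.finite.subset (Set.inter_subset_left (t := closedSquare R))
      refine ⟨hfin, ?_⟩
      have h1 : (S ∩ closedSquare R).ncard ≤ 1 :=
        (Set.ncard_le_one hfin).2 fun a ha b hb => hsub ha.1 hb.1
      have h2 : 1 ≤ R ^ (2 / 3 : ℝ) := Real.one_le_rpow hR (by norm_num)
      have h3 : ((S ∩ closedSquare R).ncard : ℝ) ≤ 1 := by exact_mod_cast h1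
      nlinarith
  · have htop : S.einfsep ≠ ⊤ := hnt.einfsep_ne_top
    set e := S.einfsep.toReal with he
    have hofe : ENNReal.ofReal e = S.einfsep := ENNReal.ofReal_toReal htop
    have hep : 0 < e := ENNReal.toReal_pos hpos.ne' htop
    have hsep : ∀ z ∈ S, ∀ w ∈ S, z ≠ w → e ≤ dist z w := by
      intro z hz w hw hzw
      have := Set.einfsep_le_edist_of_mem hz hw hzw
      rwa [← hofe, edist_dist, ENNReal.ofReal_le_ofReal_iff dist_nonneg] at this
    obtain ⟨p, hp, q, hq, hpq, hlt⟩ : ∃ p ∈ S, ∃ q ∈ S, p ≠ q ∧ dist p q < 2 * e := by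
      have : S.einfsep < ENNReal.ofReal (2 * e) := by
        rw [← hofe]
        exact (ENNReal.ofReal_lt_ofReal_iff (by positivity)).2 (by linarith)
      obtain ⟨p, hp, q, hq, hpq, h⟩ := Set.einfsep_lt_iff.1 this
      refine ⟨p, hp, q, hq, hpq, ?_⟩
      rwa [edist_dist, ENNReal.ofReal_lt_ofReal_iff (by positivity)] at h
    obtain ⟨Φ, hΦ, hΦp, hΦq⟩ := exists_isometry_foci p q
    obtain ⟨hfin, hcard⟩ := Set.finite_and_ncard_le_of_forall_finset
      (card_le_of_isometry hK hp hq (dist_pos.2 hpq) hΦ hΦp hΦq hgood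
        (fun z hz w hw hzw => le_trans (by linarith) (hsep z hz w hw hzw)))
    have hcard' : (S.ncard : ℝ) ≤ 2 * K * e := by nlinarith
    constructor
    · rw [← hofe, ← ENNReal.ofReal_mul (by positivity), ← hfin.cast_ncard_eq, ENat.toENNReal_coe,
        ← ENNReal.ofReal_natCast]
      exact ENNReal.ofReal_le_ofReal hcard'
    · intro R hR
      have hfin' := hfin.subset (Set.inter_subset_left (t := closedSquare R))
      have hRp : 0 ≤ R ^ (2 / 3 : ℝ) := by positivity
      refine ⟨hfin', ?_⟩
      rcases le_total e (R ^ (2 / 3 : ℝ)) with h | h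
      · have h1 : ((S ∩ closedSquare R).ncard : ℝ) ≤ S.ncard := by
          exact_mod_cast Set.ncard_le_ncard Set.inter_subset_left hfin
        nlinarith
      · have h1 := card_inter_closedSquare_le hR h (G := hfin'.toFinset)
          (fun z hz => ((hfin'.mem_toFinset).1 hz).2)
          (fun z hz w hw => hsep z ((hfin'.mem_toFinset).1 hz).1 w ((hfin'.mem_toFinset).1 hw).1)
        rw [← Set.ncard_eq_toFinset_card _ hfin'] at h1
        nlinarith
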